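/- **Setting.** Let $\gamma_N=\bigotimes_{i=1}^N\mathcal N(0,1)$ on $\mathbb R^N$ and $\gamma=\bigotimes_{j\in\mathbb N}\mathcal N(0,1)$ on $\mathbb R^\infty$. Let $\mathcal F$ be the set of finitely supported $\nu=(\nu_j)_{j\ge1}\in\mathbb N_0^\infty$. For $\nu\in\mathcal F$ put $H_\nu(y)=\prod_j H_{\nu_j}(y_j)$, where $H_k=\mathrm{He}_k/\sqrt{k!}$ is the $k$-th probabilists' Hermite polynomial, normalized in $L^2(\mathbb R,\mathcal N(0,1))$. For $M\in\mathbb N$ and $\varrho\in(0,\infty)^\infty$ put $$\beta_\nu(M,\varrho)=\prod_{j\in\mathbb N}\Big(\sum_{\ell=0}^{M}\binom{\nu_j}{\ell}\varrho_j^{2\ell}\Big),\qquad \nu\in\mathcal F.$$ Let $X$ be a complex separable Hilbert space, $b=(b_j)_{j\in\mathbb N}\in(0,\infty)^\infty$, $\xi>0$, $\delta>0$. A vector $\varrho\in(0,\infty)^N$ is called *admissible* if $\sum_{j=1}^N b_j^2\varrho_j^2\le\xi^2$. For such $\varrho$ let $\mathcal S_\varrho=\{z\in\mathbb C^N:|\Im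 z_i|<\varrho_i\ \forall i\}$ and $\mathcal B(\varrho)=\{z\in\mathbb C^N:|z_i|<\varrho_i\ \forall i\}$. A function $u\in L^2_\gamma(\mathbb R^\infty,X)$ is *$(b,\xi,2,\delta,X)$-holomorphic* if there are functions $u_N:\mathbb R^N\to X$, $N\in\mathbb N$, such that 1. for every $N$ and every admissible $\varrho\in(0,\infty)^N$, $u_N$ has a holomorphic extension (again denoted $u_N$) to $\mathcal S_\varrho$, and $u_N(y_1,\dots,y_N)=u_K(y_1,\dots,y_N,0,\dots,0)$ for all $N<K$ and $y\in\mathbb R^N$; 2. for every $N$ there is $\varphi_N:\mathbb R^N\to[0,\infty)$ with $\|\varphi_N\|_{L^2_{\gamma_N}(\mathbb R^N)}\le\delta$ and $\|u_N(y+z)\|_X\le\varphi_N(y)$ for all $y\in\mathbb R^N$, all admissible $\varrho\in(0,\infty)^N$ and all $z\in\mathcal B(\varrho)$; 3. with $\tilde u_N(y)=u_N(y_1,\dots,y_N)$ for $y\in\mathbb R^\infty$, $\lim_{N\to\infty}\|u-\tilde u_N\|_{L^2_\gamma(\mathbb R^\infty,X)}=0$. **Theorem.** Let $p\in(0,2)$,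 let $b\in(0,\infty)^\infty\cap\ell^p(\mathbb N)$, let $u$ be $(b,\xi,2,\delta,X)$-holomorphic, let $M\in\mathbb N$ with $M\ge 2/p$, and let $\varrho\in(0,\infty)^\infty$ be given by $$\varrho_j^2b_j^2=\Big(\frac{b_j}{\|b\|_{\ell^p}}\Big)^p\frac{\xi^2}{8e\,M!}\qquad\text{for all } j\in\mathbb N.$$ Let $u_\nu=\int_{\mathbb R^\infty}u(y)H_\nu(y)\,\gamma(dy)\in X$, $\nu\in\mathcal F$, be the Wiener–Hermite coefficients of $u$. Then $$\sum_{\nu\in\mathcal F}\beta_\nu(M,\varrho)\|u_\nu\|_X^2\le 2\delta^2,\qquad \big(\beta_\nu(M,\varrho)^{-1}\big)_{\nu\in\mathcal F}\in\ell^{p/(2-p)}(\mathcal F),$$ and furthermore $(\|u_\nu\|_X)_{\nu\in\mathcal F}\in\ell^p(\mathcal F)$. -/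

import Mathlib

open MeasureTheory ProbabilityTheory Filter Topology
open scoped ENNReal

namespace GaussHol

/-- The standard Gaussian product measure `γ_N = ⨂_{i=1}^N 𝒩(0,1)` on `ℝ^N`. -/
noncomputable def gaussN (N : ℕ) : Measure (Fin N → ℝ) :=
  Measure.pi fun _ => gaussianReal 0 1

/-- The standard Gaussian product measure `γ = ⨂_{j} 𝒩(0,1)` on `ℝ^∞`. -/
noncomputable def gaussInf : Measure (ℕ → ℝ) :=
  Measure.infinitePi fun _ => gaussianReal 0 1

/-- The normalized probabilists' Hermite polynomial `H_k = He_k / √(k!)`, as a function on `ℝ`.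
These form an orthonormal basis of `L²(ℝ, 𝒩(0,1))`. -/
noncomputable def hermiteFun (k : ℕ) (x : ℝ) : ℝ :=
  Polynomial.aeval x (Polynomial.hermite k) / Real.sqrt (k.factorial : ℝ)

/-- The tensorized Hermite polynomial `H_ν(y) = ∏_j H_{ν_j}(y_j)` for a finitely supported
multi-index `ν` (the factors with `ν_j = 0` equal `1`). -/
noncomputable def hermiteMulti (ν : ℕ →₀ ℕ) (y : ℕ → ℝ) : ℝ :=
  ∏ j ∈ ν.support, hermiteFun (ν j) (y j)

/-- The weight `β_ν(M, ϱ) = ∏_j ∑_{ℓ=0}^M binom(ν_j, ℓ) ϱ_j^{2ℓ}`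
(the factors with `ν_j = 0` equal `1`). -/
noncomputable def betaWeight (M : ℕ) (ϱ : ℕ → ℝ) (ν : ℕ →₀ ℕ) : ℝ :=
  ∏ j ∈ ν.support, ∑ l ∈ Finset.range (M + 1), ((ν j).choose l : ℝ) * ϱ j ^ (2 * l)

/-- The vector `ϱ ∈ (0,∞)^N` is `(b, ξ, r)`-admissible, where `b` enters through its first `N`
entries, and `r ∈ [1,∞]`. -/
def IsAdmissible (b : ℕ → ℝ) (ξ : ℝ) (r : ℝ≥0∞) {N : ℕ} (ϱ : Fin N → ℝ) : Prop :=
  (∀ j, 0 < ϱ j) ∧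
    (r ≠ ∞ → ∑ j : Fin N, b j ^ r.toReal * ϱ j ^ r.toReal ≤ ξ ^ r.toReal) ∧
    (r = ∞ → ∀ j : Fin N, b j * ϱ j ≤ ξ)

/-- The open strip `{z ∈ ℂ^N : |Im z_i| < ϱ_i for all i}`. -/
def strip {N : ℕ} (ϱ : Fin N → ℝ) : Set (Fin N → ℂ) :=
  {z | ∀ i, |(z i).im| < ϱ i}

/-- The open polydisc `{z ∈ ℂ^N : |z_i| < ϱ_i for all i}`. -/
def polydisc {N : ℕ} (ϱ : Fin N → ℝ) : Set (Fin N → ℂ) :=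
  {z | ∀ i, ‖z i‖ < ϱ i}

/-- The inclusion `ℝ^N ⊆ ℂ^N`. -/
def toComplex {N : ℕ} (y : Fin N → ℝ) : Fin N → ℂ := fun i => (y i : ℂ)

variable {X : Type*} [NormedAddCommGroup X] [InnerProductSpace ℂ X]

/-- `F` restricts to a holomorphic function on the strip of half-widths `ϱ`, and extends `f`. -/
def IsHolExtension {N : ℕ} (f : (Fin N → ℝ) → X) (ϱ : Fin N → ℝ) (F : (Fin N → ℂ) → X) : Prop :=
  DifferentiableOn ℂ F (strip ϱ) ∧ ∀ y, F (toComplex y) = f y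

/-- The family `(v_N)_{N ≥ 1}` of functions `v_N : ℝ^N → X` witnesses `(b, ξ, r, δ, X)`-holomorphy
of `u`. (The holomorphic extension of `v_N` to a strip is unique on that strip, so quantifying
over all extensions in `bounded` is the same as speaking of the extension.) -/
structure IsHolomorphicFamily (u : (ℕ → ℝ) → X) (b : ℕ → ℝ) (ξ : ℝ) (r : ℝ≥0∞) (δ : ℝ)
    (v : (N : ℕ) → (Fin N → ℝ) → X) : Prop where
  /-- every `v_N` extends holomorphically to every admissible strip -/
  extends_hol : ∀ N : ℕ, 1 ≤ N → ∀ ϱ : Fin N → ℝ, IsAdmissible b ξ r ϱ →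
    ∃ F : (Fin N → ℂ) → X, IsHolExtension (v N) ϱ F
  /-- `v_N(y_1,…,y_N) = v_K(y_1,…,y_N,0,…,0)` for `N < K` -/
  consistent : ∀ N K : ℕ, 1 ≤ N → N < K → ∀ y : Fin N → ℝ,
    v N y = v K fun i => if h : (i : ℕ) < N then y ⟨i, h⟩ else 0
  /-- the uniform bound by `φ_N`, where `‖φ_N‖_{L²(γ_N)} ≤ δ` -/
  bounded : ∀ N : ℕ, 1 ≤ N → ∃ φ : (Fin N → ℝ) → ℝ, (∀ y, 0 ≤ φ y) ∧
    MemLp φ 2 (gaussN N) ∧ eLpNorm φ 2 (gaussN N) ≤ ENNReal.ofReal δ ∧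
    ∀ ϱ : Fin N → ℝ, IsAdmissible b ξ r ϱ → ∀ F : (Fin N → ℂ) → X, IsHolExtension (v N) ϱ F →
      ∀ y : Fin N → ℝ, ∀ z ∈ polydisc ϱ, ‖F (toComplex y + z)‖ ≤ φ y
  /-- `v_N(y_1,…,y_N) → u(y)` in `L²(γ; X)` -/
  converges : Tendsto
    (fun N : ℕ => eLpNorm (fun y : ℕ → ℝ => u y - v N fun i : Fin N => y i) 2 gaussInf)
    atTop (𝓝 0)

/-- `u ∈ L²_γ(ℝ^∞, X)` is `(b, ξ, r, δ, X)`-holomorphic. -/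
def IsParamHolomorphic (u : (ℕ → ℝ) → X) (b : ℕ → ℝ) (ξ : ℝ) (r : ℝ≥0∞) (δ : ℝ) : Prop :=
  MemLp u 2 gaussInf ∧ ∃ v : (N : ℕ) → (Fin N → ℝ) → X, IsHolomorphicFamily u b ξ r δ v

/-- The Wiener–Hermite coefficient `u_ν = ∫ u(y) H_ν(y) γ(dy) ∈ X`. -/
noncomputable def hermiteCoeff (u : (ℕ → ℝ) → X) (ν : ℕ →₀ ℕ) : X :=
  ∫ y, (hermiteMulti ν y : ℂ) • u y ∂gaussInf

end GaussHol

/-!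
The Hermite coefficients of a holomorphic function are controlled through its Taylor terms. Let
`v` be one of the finite-dimensional approximations, `τ` a multi-index and `r` a vector of radii
such that `√2 r` is admissible. The function `F(y + r e^{iθ})` of `y ∈ ℝ^N` and of `N` angles is
bounded by `φ(y)`, so its norm in `L²` of Gaussian times uniform measure is at most `δ`. Its
coefficients against the orthonormal system `e^{-iτθ} H_m(y)`, `τ` fixed, are by Cauchy's formula
the Hermite coefficients of the Taylor term of index `τ`, and by Gaussian integration by parts these
are `r^τ / τ! · √((m+τ)!/m!) · v_{m+τ}`. Bessel's inequality therefore gives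
`∑_ν binom(ν, τ) ‖v_ν‖² ≤ τ! r^{-2τ} δ²` (`sum_choose_mul_norm_hermiteCoeffN_sq_le`). Working with
the angles as additional integration variables avoids derivatives in several variables: the
identity is proved in one variable (`integral_circleWeight_smul`) and carried over one coordinate
at a time by resampling that coordinate (`integral_mixed_insert`).

The weight expands as `β_ν = ∑_{τ ≤ M} binom(ν, τ) ϱ^{2τ}`. With `r_j² b_j²` essentially
proportional to `τ_j / |τ|`, the bounds `n^n ≤ e^n n!` and `τ_j! ≤ M!` turn the sum over `τ` into
a multinomial series dominated by `∑_n 2^{-n} = 2`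
(`sum_prod_mul_norm_hermiteCoeffN_sq_le`). The coefficients of `u` are the limits of those of the
approximations, so the bound `2 δ²` passes to `u`.

For `q = p / (2 - p)`, each factor of `β_ν` with `ν_j ≥ 1` is at least a constant times
`ν_j^M ϱ_j²`, so that `∑_ν β_ν^{-q}` is dominated by a product `∏_j (1 + c ϱ_j^{-2q} ∑_n n^{-Mq})`;
it converges since `M q > 1` and `ϱ_j^{-2q}` is a multiple of `b_j^p`
(`summable_betaWeight_inv_rpow`). The `ℓ^p` summability of the coefficients follows by Hölder's
inequality, used in the pointwise form `rpow_le_mul_sq_add_inv_rpow`.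
-/

open MeasureTheory ProbabilityTheory Filter Topology
open scoped ENNReal

namespace GaussHol

/-! ### Hermite polynomials and the Gaussian measure on the line -/

theorem integrable_polynomial_gaussianReal (P : Polynomial ℤ) :
    Integrable (fun x : ℝ => Polynomial.aeval x P) (gaussianReal 0 1) := by
  induction P using Polynomial.induction_on' with
  | add p q hp hq =>
    simp only [map_add]
    exact hp.add hq
  | monomial n a =>
    have h : Integrable (fun x : ℝ => x ^ n) (gaussianReal 0 1) := by
      rcases Nat.eq_zero_or_pos n with rfl | hn
      · simp
      · have := (memLp_id_gaussianReal (μ := 0) (v := 1) (n : NNReal)).integrable_norm_pow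
          hn.ne'
        refine this.mono (by fun_prop) (ae_of_all _ fun x => ?_)
        simp
    simpa [Polynomial.aeval_monomial] using h.const_mul (a : ℝ)

theorem memLp_polynomial_gaussianReal (P : Polynomial ℤ) :
    MemLp (fun x : ℝ => Polynomial.aeval x P) 2 (gaussianReal 0 1) := by
  have hc : Continuous fun x : ℝ => Polynomial.aeval x P := P.continuous_aeval
  rw [memLp_two_iff_integrable_sq hc.aestronglyMeasurable]
  simp_rw [← map_pow]
  exact integrable_polynomial_gaussianReal (P ^ 2)

theorem continuous_hermiteFun (k : ℕ) : Continuous (hermiteFun k) :=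
  (Polynomial.continuous_aeval _).div_const _

theorem memLp_hermiteFun (k : ℕ) : MemLp (hermiteFun k) 2 (gaussianReal 0 1) := by
  have h : hermiteFun k = fun x => (√(k.factorial : ℝ))⁻¹ *
      Polynomial.aeval x (Polynomial.hermite k) := by
    ext x
    rw [hermiteFun, div_eq_inv_mul]
  rw [h]
  exact (memLp_polynomial_gaussianReal (Polynomial.hermite k)).const_mul _

theorem hasDerivAt_gaussianPDFReal (x : ℝ) :
    HasDerivAt (gaussianPDFReal 0 1) (-x * gaussianPDFReal 0 1 x) x := by
  have h : HasDerivAt (fun x : ℝ => (√(2 * Real.pi * (1 : NNReal)))⁻¹ *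
      Real.exp (-(x - 0) ^ 2 / (2 * (1 : NNReal)))) ((√(2 * Real.pi * (1 : NNReal)))⁻¹ *
      (Real.exp (-(x - 0) ^ 2 / (2 * (1 : NNReal))) *
        (-(2 * (x - 0) ^ (2 - 1) * 1) / (2 * (1 : NNReal))))) x := by
    refine HasDerivAt.const_mul _ (HasDerivAt.exp (HasDerivAt.div_const (HasDerivAt.neg ?_) _))
    exact ((hasDerivAt_id x).sub_const 0).pow 2
  convert h using 1
  · exact gaussianPDFReal_def 0 1
  · simp only [gaussianPDFReal_def, NNReal.coe_one]
    ring

theorem hasDerivAt_hermite_mul_gaussianPDFReal (m : ℕ) (x : ℝ) :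
    HasDerivAt (fun x => gaussianPDFReal 0 1 x * Polynomial.aeval x (Polynomial.hermite m))
      (-(gaussianPDFReal 0 1 x * Polynomial.aeval x (Polynomial.hermite (m + 1)))) x := by
  have h := (hasDerivAt_gaussianPDFReal x).mul ((Polynomial.hermite m).hasDerivAt_aeval x)
  convert! h using 1
  rw [Polynomial.hermite_succ, map_sub, map_mul, Polynomial.aeval_X]
  ring

theorem integrable_gaussianReal_iff {E : Type*} [NormedAddCommGroup E] [NormedSpace ℝ E]
    (f : ℝ → E) :
    Integrable f (gaussianReal 0 1) ↔ Integrable fun x => gaussianPDFReal 0 1 x • f x := by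
  rw [gaussianReal_of_var_ne_zero _ one_ne_zero, integrable_withDensity_iff_integrable_smul'
    (measurable_gaussianPDF _ _) (ae_of_all _ fun _ => gaussianPDF_lt_top)]
  simp only [toReal_gaussianPDF]

/-- Gaussian integration by parts: multiplication by `He_m ↦ He_{m+1}` is dual to
differentiation, because `(He_m e^{-x²/2})' = -He_{m+1} e^{-x²/2}`. -/
theorem integral_hermite_smul_deriv {E : Type*} [NormedAddCommGroup E] [NormedSpace ℝ E]
    {g g' : ℝ → E} (m : ℕ) (hg : ∀ x, HasDerivAt g (g' x) x)
    (h1 : Integrable (fun x : ℝ => (Polynomial.aeval x (Polynomial.hermite m) : ℝ) • g' x)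
      (gaussianReal 0 1))
    (h2 : Integrable (fun x : ℝ => (Polynomial.aeval x (Polynomial.hermite m) : ℝ) • g x)
      (gaussianReal 0 1))
    (h3 : Integrable (fun x : ℝ => (Polynomial.aeval x (Polynomial.hermite (m + 1)) : ℝ) • g x)
      (gaussianReal 0 1)) :
    ∫ x, (Polynomial.aeval x (Polynomial.hermite m) : ℝ) • g' x ∂gaussianReal 0 1 =
      ∫ x, (Polynomial.aeval x (Polynomial.hermite (m + 1)) : ℝ) • g x ∂gaussianReal 0 1 := by
  rw [integrable_gaussianReal_iff] at h1 h2 h3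
  simp only [integral_gaussianReal_eq_integral_smul one_ne_zero, smul_smul] at *
  have := integral_bilinear_hasDerivAt_right_eq_neg_left_of_integrable
    (L := ContinuousLinearMap.lsmul ℝ ℝ (E := E))
    (u := fun x => gaussianPDFReal 0 1 x * Polynomial.aeval x (Polynomial.hermite m))
    (v := g) (v' := g') (fun x _ => hasDerivAt_hermite_mul_gaussianPDFReal m x)
    (fun x _ => hg x) (by simpa using h1)
    (by simpa only [ContinuousLinearMap.lsmul_apply, neg_smul] using! h3.neg) (by simpa using h2)
  simpa only [ContinuousLinearMap.lsmul_apply, neg_smul, integral_neg, neg_neg] using this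

theorem integral_hermite_mul_polynomial (n : ℕ) (P : Polynomial ℤ) :
    ∫ x : ℝ, Polynomial.aeval x (Polynomial.hermite n) * Polynomial.aeval x P
        ∂gaussianReal 0 1 =
      ∫ x : ℝ, Polynomial.aeval x (Polynomial.derivative^[n] P) ∂gaussianReal 0 1 := by
  induction n generalizing P with
  | zero => simp
  | succ n ih =>
    rw [Function.iterate_succ_apply, ← ih]
    have hi (Q R : Polynomial ℤ) : Integrable
        (fun x : ℝ => (Polynomial.aeval x Q : ℝ) • (Polynomial.aeval x R : ℝ))
        (gaussianReal 0 1) := by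
      simpa using integrable_polynomial_gaussianReal (Q * R)
    exact (integral_hermite_smul_deriv n (fun x => P.hasDerivAt_aeval x) (hi _ _) (hi _ _)
      (hi _ _)).symm

theorem integral_hermite_mul_hermite_of_lt {m n : ℕ} (h : m < n) :
    ∫ x : ℝ, Polynomial.aeval x (Polynomial.hermite n) * Polynomial.aeval x (Polynomial.hermite m)
        ∂gaussianReal 0 1 = 0 := by
  rw [integral_hermite_mul_polynomial, Polynomial.iterate_derivative_eq_zero (by simpa using h)]
  simp

theorem integral_hermite_sq (n : ℕ) :
    ∫ x : ℝ, Polynomial.aeval x (Polynomial.hermite n) * Polynomial.aeval x (Polynomial.hermite n)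
        ∂gaussianReal 0 1 = n.factorial := by
  have h : Polynomial.derivative^[n] (Polynomial.hermite n) = Polynomial.C (n.factorial : ℤ) := by
    ext i
    rw [Polynomial.coeff_iterate_derivative, Polynomial.coeff_C]
    split_ifs with hi
    · subst hi
      simp [Polynomial.coeff_hermite_self, Nat.descFactorial_self]
    · simp [Polynomial.coeff_hermite_of_lt (show n < i + n by omega)]
  rw [integral_hermite_mul_polynomial, h]
  simp

/-- The normalized Hermite polynomials are orthonormal in `L²(𝒩(0,1))`. -/
theorem integral_hermiteFun_mul_hermiteFun (m n : ℕ) :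
    ∫ x, hermiteFun m x * hermiteFun n x ∂gaussianReal 0 1 = if m = n then 1 else 0 := by
  have h : ∀ x, hermiteFun m x * hermiteFun n x = (√(m.factorial : ℝ) * √(n.factorial : ℝ))⁻¹ *
      ((Polynomial.aeval x (Polynomial.hermite m) : ℝ) *
        Polynomial.aeval x (Polynomial.hermite n)) := by
    intro x
    simp only [hermiteFun]
    field_simp
  simp only [h, integral_const_mul]
  rcases lt_trichotomy m n with hmn | rfl | hmn
  · simp_rw [mul_comm (Polynomial.aeval _ (Polynomial.hermite m) : ℝ)]
    simp [integral_hermite_mul_hermite_of_lt hmn, hmn.ne]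
  · rw [integral_hermite_sq, Real.mul_self_sqrt (by positivity), if_pos rfl]
    exact inv_mul_cancel₀ (by positivity)
  · simp [integral_hermite_mul_hermite_of_lt hmn, hmn.ne']

/-! ### Cauchy's formula against a Hermite polynomial in one variable -/

section Cauchy

variable {X : Type*} [NormedAddCommGroup X] [NormedSpace ℂ X] [CompleteSpace X]

theorem isOpen_im_lt (κ : ℝ) : IsOpen {z : ℂ | |z.im| < κ} :=
  isOpen_lt (continuous_abs.comp Complex.continuous_im) continuous_const

theorem abs_im_add_lt {κ : ℝ} {s : ℝ} {ζ : ℂ} (h : ‖ζ‖ < κ) : |((s : ℂ) + ζ).im| < κ := by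
  simpa using (Complex.abs_im_le_norm ζ).trans_lt h

theorem closedBall_subset_strip {κ r : ℝ} (hr : r < κ) (s : ℝ) :
    Metric.closedBall (s : ℂ) r ⊆ {z : ℂ | |z.im| < κ} := by
  intro z hz
  rw [mem_closedBall_iff_norm] at hz
  simpa using abs_im_add_lt (s := s) (hz.trans_lt hr)

theorem hasDerivAt_iteratedDeriv_ofReal {g : ℂ → X} {κ : ℝ} (hκ : 0 < κ)
    (hg : DifferentiableOn ℂ g {z | |z.im| < κ}) (k : ℕ) (s : ℝ) :
    HasDerivAt (fun t : ℝ => iteratedDeriv k g t) (iteratedDeriv (k + 1) g s) s := by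
  have hs : {z : ℂ | |z.im| < κ} ∈ 𝓝 (s : ℂ) := (isOpen_im_lt κ).mem_nhds (by simpa using hκ)
  have : HasDerivAt (iteratedDeriv k g) (iteratedDeriv (k + 1) g s) (s : ℂ) := by
    rw [iteratedDeriv_succ]
    have han := (hg.analyticOnNhd (isOpen_im_lt κ)).iterated_deriv k s (mem_of_mem_nhds hs)
    rw [← iteratedDeriv_eq_iterate] at han
    exact han.differentiableAt.hasDerivAt
  simpa using! this.scomp s Complex.ofRealCLM.hasDerivAt

/-- Cauchy's formula for the `k`-th Taylor term as an average over the angle. -/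
theorem circleMap_average_eq_iteratedDeriv {g : ℂ → X} {κ r : ℝ} (hr : 0 < r) (hrκ : r < κ)
    (hg : DifferentiableOn ℂ g {z | |z.im| < κ}) (k : ℕ) (s : ℝ) :
    (2 * Real.pi)⁻¹ • ∫ θ in (0 : ℝ)..2 * Real.pi,
        Complex.exp (-(k * θ * Complex.I)) • g (s + r * Complex.exp (θ * Complex.I)) =
      ((r : ℂ) ^ k / k.factorial) • iteratedDeriv k g s := by
  have h := (hg.mono (closedBall_subset_strip hrκ s)).circleIntegral_one_div_sub_center_pow_smul
    hr k
  have hpi : (2 * (Real.pi : ℂ) * Complex.I) ≠ 0 := Complex.two_pi_I_ne_zero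
  have h' : iteratedDeriv k g s = ((k.factorial : ℂ) / (2 * Real.pi * Complex.I)) •
      ∮ z in C((s : ℂ), r), (1 / (z - s) ^ (k + 1)) • g z := by
    rw [h, smul_smul, div_mul_div_comm, mul_comm, div_self, one_smul]
    exact mul_ne_zero hpi (by exact_mod_cast k.factorial_ne_zero)
  have hr' : (r : ℂ) ≠ 0 := by exact_mod_cast hr.ne'
  have hk : (k.factorial : ℂ) ≠ 0 := by exact_mod_cast k.factorial_ne_zero
  rw [h', circleIntegral, smul_smul, ← Complex.coe_smul, ← intervalIntegral.integral_smul,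
    ← intervalIntegral.integral_smul]
  refine intervalIntegral.integral_congr fun θ _ => ?_
  simp only [deriv_circleMap, smul_smul, circleMap]
  congr 1
  have he : Complex.exp (θ * Complex.I) ≠ 0 := Complex.exp_ne_zero _
  rw [show -((k : ℂ) * θ * Complex.I) = -(k * (θ * Complex.I)) by ring, Complex.exp_neg,
    Complex.exp_nat_mul]
  push_cast
  rw [show (s : ℂ) + r * Complex.exp (θ * Complex.I) - s = r * Complex.exp (θ * Complex.I) by ring,
    zero_add]
  have : (Real.pi : ℂ) ≠ 0 := by exact_mod_cast Real.pi_ne_zero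
  rw [mul_pow, pow_succ, pow_succ]
  field_simp

/-- Repeated Gaussian integration by parts for a function which is holomorphic in a strip. -/
theorem integral_hermite_smul_iteratedDeriv {g : ℂ → X} {κ r : ℝ} (hr : 0 < r) (hrκ : r < κ)
    (hg : DifferentiableOn ℂ g {z | |z.im| < κ}) {φ : ℝ → ℝ} (hφ : MemLp φ 2 (gaussianReal 0 1))
    (hb : ∀ (s : ℝ) (ζ : ℂ), ‖ζ‖ < κ → ‖g (s + ζ)‖ ≤ φ s) (m k : ℕ) :
    ∫ s : ℝ, (Polynomial.aeval s (Polynomial.hermite m) : ℝ) • iteratedDeriv k g s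
        ∂gaussianReal 0 1 =
      ∫ s : ℝ, (Polynomial.aeval s (Polynomial.hermite (m + k)) : ℝ) • g s
        ∂gaussianReal 0 1 := by
  have hκ := hr.trans hrκ
  have hbd (k : ℕ) (s : ℝ) : ‖iteratedDeriv k g s‖ ≤ k.factorial / r ^ k * φ s := by
    have hd : DiffContOnCl ℂ g (Metric.ball (s : ℂ) r) :=
      (hg.mono (Metric.closure_ball_subset_closedBall.trans
        (closedBall_subset_strip hrκ s))).diffContOnCl
    have := Complex.norm_iteratedDeriv_le_of_forall_mem_sphere_norm_le (C := φ s) k hr hd ?_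
    · exact this.trans_eq (by ring)
    · intro z hz
      have := hb s (z - s) (by rw [mem_sphere_iff_norm] at hz; rwa [hz])
      simpa using this
  have hcont (k : ℕ) : Continuous fun s : ℝ => iteratedDeriv k g s :=
    continuous_iff_continuousAt.2 fun s => (hasDerivAt_iteratedDeriv_ofReal hκ hg k s).continuousAt
  have hint (m k : ℕ) : Integrable (fun s : ℝ =>
      (Polynomial.aeval s (Polynomial.hermite m) : ℝ) • iteratedDeriv k g s)
      (gaussianReal 0 1) := by
    have hp : Continuous fun s : ℝ => (Polynomial.aeval s (Polynomial.hermite m) : ℝ) :=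
      Polynomial.continuous_aeval _
    have := ((memLp_polynomial_gaussianReal (Polynomial.hermite m)).integrable_mul hφ).const_mul
      (k.factorial / r ^ k)
    refine this.mono (hp.smul (hcont k)).aestronglyMeasurable (ae_of_all _ fun s => ?_)
    rw [norm_smul, Pi.mul_apply, mul_left_comm, norm_mul]
    gcongr
    exact (hbd k s).trans (le_abs_self _)
  induction k generalizing m with
  | zero => simp
  | succ k ih =>
    rw [integral_hermite_smul_deriv m (hasDerivAt_iteratedDeriv_ofReal hκ hg k) (hint _ _)
      (hint _ _) (hint _ _), ih, add_right_comm, add_assoc]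

end Cauchy

/-! ### Bessel's inequality for Hilbert-space valued functions -/

section Bessel

variable {Ω : Type*} [MeasurableSpace Ω] {μ : Measure Ω}
  {X : Type*} [NormedAddCommGroup X] [InnerProductSpace ℂ X]

theorem memLp_smul_const {K : Ω → ℂ} (hK : MemLp K 2 μ) (c : X) :
    MemLp (fun ω => K ω • c) 2 μ := by
  refine (hK.norm.mul_const ‖c‖).mono (hK.1.smul_const c) (ae_of_all _ fun ω => ?_)
  simp [norm_smul]

theorem integrable_smul_of_memLp {K : Ω → ℂ} (hK : MemLp K 2 μ) {f : Ω → X} (hf : MemLp f 2 μ) :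
    Integrable (fun ω => K ω • f ω) μ :=
  memLp_one_iff_integrable.1 (hf.smul hK)

/-- Bessel's inequality for scalar orthonormal functions and a Hilbert-space valued `f`. -/
theorem sum_norm_integral_smul_sq_le [CompleteSpace X] {ι : Type*} (A : Finset ι) {K : ι → Ω → ℂ}
    (hK : ∀ i ∈ A, MemLp (K i) 2 μ)
    (horth : ∀ i ∈ A, ∀ j ∈ A, ∫ ω, K i ω * (starRingEnd ℂ) (K j ω) ∂μ =
      open Classical in if i = j then 1 else 0)
    {f : Ω → X} (hf : MemLp f 2 μ) :
    ∑ i ∈ A, ‖∫ ω, K i ω • f ω ∂μ‖ ^ 2 ≤ (eLpNorm f 2 μ).toReal ^ 2 := by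
  classical
  set c : ι → X := fun i => ∫ ω, K i ω • f ω ∂μ with hc
  -- `g` is the orthogonal projection of `f` onto the span of the conjugates of the `K i`.
  set g : Ω → X := fun ω => ∑ i ∈ A, (starRingEnd ℂ) (K i ω) • c i with hg
  have hKc : ∀ i ∈ A, MemLp (fun ω => (starRingEnd ℂ) (K i ω)) 2 μ := fun i hi => (hK i hi).star
  have hgm : MemLp g 2 μ := memLp_finsetSum A fun i hi => memLp_smul_const (hKc i hi) (c i)
  have hinner {h : Ω → X} (hh : MemLp h 2 μ) :
      inner ℂ (hgm.toLp g) (hh.toLp h) = ∑ i ∈ A, inner ℂ (c i) (∫ ω, K i ω • h ω ∂μ) := by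
    have hint : ∀ i ∈ A, Integrable (fun ω => K i ω • h ω) μ := fun i hi =>
      integrable_smul_of_memLp (hK i hi) hh
    rw [L2.inner_def]
    calc ∫ ω, inner ℂ (hgm.toLp g ω) (hh.toLp h ω) ∂μ
        = ∫ ω, ∑ i ∈ A, inner ℂ (c i) (K i ω • h ω) ∂μ := by
          refine integral_congr_ae ?_
          filter_upwards [hgm.coeFn_toLp, hh.coeFn_toLp] with ω h1 h2
          rw [h1, h2, hg, sum_inner]
          simp [inner_smul_left]
      _ = ∑ i ∈ A, inner ℂ (c i) (∫ ω, K i ω • h ω ∂μ) := by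
          rw [integral_finsetSum _ fun i hi => (hint i hi).const_inner (c i)]
          exact Finset.sum_congr rfl fun i hi => integral_inner (hint i hi) _
  have hcg : ∀ i ∈ A, ∫ ω, K i ω • g ω ∂μ = c i := by
    intro i hi
    simp only [hg, Finset.smul_sum, smul_smul]
    rw [integral_finsetSum]
    · simp only [integral_smul_const]
      rw [Finset.sum_congr rfl fun j hj => by rw [horth i hi j hj]]
      simp [hi]
    · intro j hj
      simpa only [smul_smul] using
        integrable_smul_of_memLp (hK i hi) (memLp_smul_const (hKc j hj) (c j))
  have hgg : inner ℂ (hgm.toLp g) (hgm.toLp g) = ((∑ i ∈ A, ‖c i‖ ^ 2 : ℝ) : ℂ) := by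
    rw [hinner hgm]
    push_cast
    exact Finset.sum_congr rfl fun i hi => by rw [hcg i hi, inner_self_eq_norm_sq_to_K]; rfl
  have hgf : inner ℂ (hgm.toLp g) (hf.toLp f) = ((∑ i ∈ A, ‖c i‖ ^ 2 : ℝ) : ℂ) := by
    rw [hinner hf]
    push_cast
    exact Finset.sum_congr rfl fun i _ => inner_self_eq_norm_sq_to_K (c i)
  have h0 : 0 ≤ ∑ i ∈ A, ‖c i‖ ^ 2 := Finset.sum_nonneg fun i _ => sq_nonneg _
  have h1 : ∑ i ∈ A, ‖c i‖ ^ 2 = ‖hgm.toLp g‖ ^ 2 := by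
    rw [inner_self_eq_norm_sq_to_K] at hgg
    exact Complex.ofReal_injective (hgg.symm.trans (by push_cast; rfl))
  have h2 : ∑ i ∈ A, ‖c i‖ ^ 2 ≤ ‖hgm.toLp g‖ * ‖hf.toLp f‖ := by
    have := norm_inner_le_norm (𝕜 := ℂ) (hgm.toLp g) (hf.toLp f)
    rwa [hgf, Complex.norm_of_nonneg h0] at this
  have h3 : ‖hf.toLp f‖ = (eLpNorm f 2 μ).toReal := Lp.norm_toLp f hf
  rw [← h3]
  nlinarith [sq_nonneg (‖hgm.toLp g‖ - ‖hf.toLp f‖), norm_nonneg (hgm.toLp g)]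

end Bessel

/-! ### Resampling one coordinate of a product measure -/

section Update

variable {ι E : Type*} [DecidableEq ι] [MeasurableSpace E]

theorem measurable_update_prod (j : ι) :
    Measurable fun p : (ι → E) × E => Function.update p.1 j p.2 := by
  refine measurable_pi_iff.2 fun i => ?_
  rcases eq_or_ne i j with rfl | hij
  · simpa using measurable_snd
  · simp only [Function.update_of_ne hij]
    fun_prop

/-- Replacing one coordinate by an independent copy preserves a product measure. -/
theorem measurePreserving_update_prod [Fintype ι] (μ : ι → Measure E) [∀ i, IsProbabilityMeasure (μ i)]
    (j : ι) : MeasurePreserving (fun p : (ι → E) × E => Function.update p.1 j p.2)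
      ((Measure.pi μ).prod (μ j)) (Measure.pi μ) := by
  refine ⟨measurable_update_prod j, (Measure.pi_eq fun s hs => ?_).symm⟩
  rw [Measure.map_apply (measurable_update_prod j) (MeasurableSet.univ_pi hs)]
  have h : (fun p : (ι → E) × E => Function.update p.1 j p.2) ⁻¹' Set.univ.pi s =
      (Set.univ.pi (Function.update s j Set.univ)) ×ˢ s j := by
    ext ⟨x, t⟩
    simp only [Set.mem_preimage, Set.mem_univ_pi, Set.mem_prod]
    constructor
    · intro h
      refine ⟨fun i => ?_, by simpa using h j⟩
      rcases eq_or_ne i j with rfl | hij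
      · simp
      · simpa [hij] using h i
    · rintro ⟨h1, h2⟩ i
      rcases eq_or_ne i j with rfl | hij
      · simpa using h2
      · simpa [hij] using h1 i
  rw [h, Measure.prod_prod, Measure.pi_pi, ← Finset.prod_erase_mul _ _ (Finset.mem_univ j),
    ← Finset.prod_erase_mul _ _ (Finset.mem_univ j)]
  simp only [Function.update_self, measure_univ, mul_one]
  congr 1
  exact Finset.prod_congr rfl fun i hi => by rw [Function.update_of_ne (Finset.ne_of_mem_erase hi)]

theorem integral_pi_eq_integral_update [Fintype ι] (μ : ι → Measure E) [∀ i, IsProbabilityMeasure (μ i)]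
    (j : ι) {X : Type*} [NormedAddCommGroup X] [NormedSpace ℝ X] {f : (ι → E) → X}
    (hf : Integrable f (Measure.pi μ)) :
    ∫ x, f x ∂Measure.pi μ =
      ∫ x, ∫ t, f (Function.update x j t) ∂μ j ∂Measure.pi μ := by
  have h := measurePreserving_update_prod μ j
  have hf' : AEStronglyMeasurable f (((Measure.pi μ).prod (μ j)).map
      fun p : (ι → E) × E => Function.update p.1 j p.2) := by
    rw [h.map_eq]; exact hf.1
  conv_lhs => rw [← h.map_eq, integral_map h.measurable.aemeasurable hf']
  exact integral_prod _ (h.integrable_comp_of_integrable hf)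

end Update

/-- On a product of probability spaces, the tensor product of `L²` functions is in `L²`. -/
theorem memLp_two_prod_pi {ι E : Type*} [Fintype ι] [MeasurableSpace E] {μ : ι → Measure E}
    [∀ i, IsProbabilityMeasure (μ i)] {a : ι → E → ℝ} (ha : ∀ i, MemLp (a i) 2 (μ i)) :
    MemLp (fun x : ι → E => ∏ i, a i (x i)) 2 (Measure.pi μ) := by
  have hm : AEStronglyMeasurable (fun x : ι → E => ∏ i, a i (x i)) (Measure.pi μ) :=
    (Integrable.fintype_prod fun i => (ha i).integrable one_le_two).1
  rw [memLp_two_iff_integrable_sq hm]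
  simp only [← Finset.prod_pow]
  exact Integrable.fintype_prod fun i => (ha i).integrable_sq

/-! ### One Gaussian variable and one angle -/

/-- The uniform probability measure on the angles `(0, 2π]`. -/
noncomputable def angleMeasure : Measure ℝ :=
  (ENNReal.ofReal (2 * Real.pi))⁻¹ • volume.restrict (Set.Ioc 0 (2 * Real.pi))

instance : IsProbabilityMeasure angleMeasure := by
  constructor
  simp only [angleMeasure, Measure.smul_apply, Measure.restrict_apply_univ, Real.volume_Ioc,
    sub_zero, smul_eq_mul]
  exact ENNReal.inv_mul_cancel (by simp [Real.pi_pos]) ENNReal.ofReal_ne_top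

theorem integral_angleMeasure {X : Type*} [NormedAddCommGroup X] [NormedSpace ℝ X] (f : ℝ → X) :
    ∫ θ, f θ ∂angleMeasure = (2 * Real.pi)⁻¹ • ∫ θ in (0 : ℝ)..2 * Real.pi, f θ := by
  rw [angleMeasure, integral_smul_measure, intervalIntegral.integral_of_le Real.two_pi_pos.le,
    ENNReal.toReal_inv, ENNReal.toReal_ofReal Real.two_pi_pos.le]

/-- The joint law of a standard Gaussian variable and an independent uniform angle. -/
noncomputable def gaussAngle : Measure (ℝ × ℝ) := (gaussianReal 0 1).prod angleMeasure

instance : IsProbabilityMeasure gaussAngle := by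
  unfold gaussAngle; infer_instance

theorem measurePreserving_fst_gaussAngle :
    MeasurePreserving Prod.fst gaussAngle (gaussianReal 0 1) :=
  measurePreserving_fst

/-- The point `y + r e^{iθ}` of the circle of radius `r` around `y`. -/
noncomputable def circlePoint (r : ℝ) (e : ℝ × ℝ) : ℂ := e.1 + r * Complex.exp (e.2 * Complex.I)

/-- The function `(y, θ) ↦ e^{-ikθ} H_m(y)`: integrating `g(y + r e^{iθ})` against it extracts
the `m`-th Hermite coefficient of the `k`-th Taylor coefficient of `g`. -/
noncomputable def circleWeight (k m : ℕ) (e : ℝ × ℝ) : ℂ :=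
  Complex.exp (-(k * e.2 * Complex.I)) * (hermiteFun m e.1 : ℂ)

/-- The factor `r^k / k! · √((m+k)!/m!)` relating the `m`-th Hermite coefficient of the `k`-th
Taylor term of radius `r` to the `(m+k)`-th Hermite coefficient. -/
noncomputable def taylorFactor (r : ℝ) (k m : ℕ) : ℝ :=
  r ^ k / k.factorial * (√((m + k).factorial : ℝ) / √(m.factorial : ℝ))

theorem taylorFactor_sq (r : ℝ) (k m : ℕ) :
    taylorFactor r k m ^ 2 = r ^ (2 * k) / k.factorial * ((m + k).choose k : ℝ) := by
  have h : ((m + k).choose k : ℝ) = (m + k).factorial / (k.factorial * m.factorial) := by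
    rw [Nat.cast_choose ℝ (Nat.le_add_left k m), Nat.add_sub_cancel]
  rw [taylorFactor, mul_pow, div_pow, div_pow, Real.sq_sqrt (by positivity),
    Real.sq_sqrt (by positivity), h, mul_comm 2 k, pow_mul]
  field_simp

theorem continuous_circlePoint (r : ℝ) : Continuous (circlePoint r) := by
  unfold circlePoint; fun_prop

theorem continuous_circleWeight (k m : ℕ) : Continuous (circleWeight k m) := by
  have := continuous_hermiteFun m
  unfold circleWeight; fun_prop

theorem norm_circleWeight (k m : ℕ) (e : ℝ × ℝ) : ‖circleWeight k m e‖ = |hermiteFun m e.1| := by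
  rw [circleWeight, norm_mul, show -((k : ℂ) * e.2 * Complex.I) = ((-(k * e.2) : ℝ) : ℂ) * Complex.I
    by push_cast; ring, Complex.norm_exp_ofReal_mul_I, one_mul, Complex.norm_real, Real.norm_eq_abs]

theorem norm_mul_exp_mul_I {r : ℝ} (hr : 0 < r) (θ : ℝ) :
    ‖(r : ℂ) * Complex.exp (θ * Complex.I)‖ = r := by
  rw [norm_mul, Complex.norm_exp_ofReal_mul_I, mul_one, Complex.norm_real, Real.norm_of_nonneg hr.le]

theorem integral_circleWeight_mul_conj (k m n : ℕ) :
    ∫ e, circleWeight k m e * (starRingEnd ℂ) (circleWeight k n e) ∂gaussAngle =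
      if m = n then 1 else 0 := by
  have h (e : ℝ × ℝ) : circleWeight k m e * (starRingEnd ℂ) (circleWeight k n e) =
      ((hermiteFun m e.1 * hermiteFun n e.1 : ℝ) : ℂ) := by
    have : Complex.exp (-(k * e.2 * Complex.I)) *
        (starRingEnd ℂ) (Complex.exp (-(k * e.2 * Complex.I))) = 1 := by
      rw [← Complex.exp_conj, ← Complex.exp_add]
      simp
    simp only [circleWeight, map_mul, Complex.conj_ofReal, Complex.ofReal_mul]
    linear_combination (hermiteFun m e.1 * hermiteFun n e.1 : ℂ) * this
  simp only [h, integral_complex_ofReal]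
  have := integral_fun_fst (μ := gaussianReal 0 1) (ν := angleMeasure)
    (fun y => hermiteFun m y * hermiteFun n y)
  rw [gaussAngle, this, integral_hermiteFun_mul_hermiteFun]
  split_ifs <;> simp

section

variable {X : Type*} [NormedAddCommGroup X] [NormedSpace ℂ X] [CompleteSpace X]

/-- In one variable, the `m`-th Hermite coefficient of the `k`-th Taylor term is a multiple of the
`(m+k)`-th Hermite coefficient: Cauchy's formula followed by `k` integrations by parts. -/
theorem integral_circleWeight_smul {g : ℂ → X} {κ r : ℝ} (hr : 0 < r) (hrκ : r < κ)
    (hg : DifferentiableOn ℂ g {z | |z.im| < κ}) {φ : ℝ → ℝ} (hφ : MemLp φ 2 (gaussianReal 0 1))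
    (hb : ∀ (s : ℝ) (ζ : ℂ), ‖ζ‖ < κ → ‖g (s + ζ)‖ ≤ φ s) (k m : ℕ) :
    ∫ e, circleWeight k m e • g (circlePoint r e) ∂gaussAngle =
      ∫ e, ((taylorFactor r k m * hermiteFun (m + k) e.1 : ℝ) : ℂ) • g e.1 ∂gaussAngle := by
  have hint : Integrable (fun e => circleWeight k m e • g (circlePoint r e)) gaussAngle := by
    have h1 := ((memLp_hermiteFun m).integrable_mul hφ).comp_fst (ν := angleMeasure)
    have hc : Continuous fun e => g (circlePoint r e) :=
      hg.continuousOn.comp_continuous (continuous_circlePoint r) fun e =>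
        abs_im_add_lt (by rwa [norm_mul_exp_mul_I hr])
    refine h1.mono ((continuous_circleWeight k m).smul hc).aestronglyMeasurable
      (ae_of_all _ fun e => ?_)
    rw [norm_smul, norm_circleWeight, Pi.mul_apply, norm_mul, Real.norm_eq_abs]
    gcongr
    exact (hb _ _ (by rwa [norm_mul_exp_mul_I hr])).trans (le_abs_self _)
  have hL : ∫ e, circleWeight k m e • g (circlePoint r e) ∂gaussAngle =
      ∫ s : ℝ, ((r : ℂ) ^ k / k.factorial) • ((hermiteFun m s : ℂ) • iteratedDeriv k g s)
        ∂gaussianReal 0 1 := by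
    rw [gaussAngle, integral_prod _ hint]
    refine integral_congr_ae (ae_of_all _ fun s => ?_)
    have := circleMap_average_eq_iteratedDeriv hr hrκ hg k s
    simp only
    rw [smul_comm, ← this, ← integral_angleMeasure, ← integral_smul]
    refine integral_congr_ae (ae_of_all _ fun θ => ?_)
    simp only [circleWeight, circlePoint, smul_smul]
    rw [mul_comm]
  have hR : ∫ e, ((taylorFactor r k m * hermiteFun (m + k) e.1 : ℝ) : ℂ) • g e.1 ∂gaussAngle =
      ∫ s : ℝ, ((taylorFactor r k m * hermiteFun (m + k) s : ℝ) : ℂ) • g s ∂gaussianReal 0 1 := by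
    have := integral_fun_fst (μ := gaussianReal 0 1) (ν := angleMeasure)
      (fun s : ℝ => ((taylorFactor r k m * hermiteFun (m + k) s : ℝ) : ℂ) • g s)
    rw [gaussAngle, this]
    simp
  have hD := integral_hermite_smul_iteratedDeriv hr hrκ hg hφ hb m k
  have h1 (s : ℝ) : ((r : ℂ) ^ k / k.factorial) • ((hermiteFun m s : ℂ) • iteratedDeriv k g s) =
      (r ^ k / k.factorial * (√(m.factorial : ℝ))⁻¹) •
        ((Polynomial.aeval s (Polynomial.hermite m) : ℝ) • iteratedDeriv k g s) := by
    rw [← Complex.coe_smul, ← Complex.coe_smul, smul_smul, smul_smul]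
    congr 1
    simp only [hermiteFun]
    push_cast
    ring
  have h2 (s : ℝ) : ((taylorFactor r k m * hermiteFun (m + k) s : ℝ) : ℂ) • g s =
      (r ^ k / k.factorial * (√(m.factorial : ℝ))⁻¹) •
        ((Polynomial.aeval s (Polynomial.hermite (m + k)) : ℝ) • g s) := by
    rw [Complex.coe_smul, smul_smul]
    congr 1
    have : √((m + k).factorial : ℝ) ≠ 0 := by positivity
    simp only [hermiteFun, taylorFactor]
    field_simp
  rw [hL, hR]
  simp only [h1, h2]
  rw [integral_smul, integral_smul, hD]

end

/-! ### Taylor terms and Hermite coefficients in finitely many variables -/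

/-- The Hermite coefficient `∫ v H_ν dγ_N` of a function of `N` variables. -/
noncomputable def hermiteCoeffN {X : Type*} [NormedAddCommGroup X] [NormedSpace ℂ X] {N : ℕ}
    (v : (Fin N → ℝ) → X) (ν : Fin N → ℕ) : X :=
  ∫ y, ((∏ j, hermiteFun (ν j) (y j) : ℝ) : ℂ) • v y ∂gaussN N

instance (N : ℕ) : IsProbabilityMeasure (gaussN N) := by
  unfold gaussN; infer_instance

/-- The law of `N` independent standard Gaussian variables and `N` independent uniform angles. -/
noncomputable def gaussAngleN (N : ℕ) : Measure (Fin N → ℝ × ℝ) :=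
  Measure.pi fun _ => gaussAngle

instance (N : ℕ) : IsProbabilityMeasure (gaussAngleN N) := by
  unfold gaussAngleN; infer_instance

theorem measurePreserving_fst_gaussAngleN (N : ℕ) :
    MeasurePreserving (fun (x : Fin N → ℝ × ℝ) j => (x j).1) (gaussAngleN N) (gaussN N) :=
  measurePreserving_pi _ _ fun _ => measurePreserving_fst_gaussAngle

theorem toComplex_add_mem_strip {N : ℕ} {κ : Fin N → ℝ} (y : Fin N → ℝ) {z : Fin N → ℂ}
    (hz : z ∈ polydisc κ) : toComplex y + z ∈ strip κ := fun i => abs_im_add_lt (hz i)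

section Tensor

variable {N : ℕ}

/-- The point with coordinates `y_j + r_j e^{iθ_j}` for `j ∈ S` and `y_j` for `j ∉ S`. -/
noncomputable def mixedPoint (r : Fin N → ℝ) (S : Finset (Fin N)) (x : Fin N → ℝ × ℝ) :
    Fin N → ℂ :=
  fun j => if j ∈ S then circlePoint (r j) (x j) else (x j).1

/-- The factor of `mixedWeight` in the coordinate `j`. -/
noncomputable def mixedFactor (r : Fin N → ℝ) (τ m : Fin N → ℕ) (S : Finset (Fin N)) (j : Fin N)
    (e : ℝ × ℝ) : ℂ :=
  if j ∈ S then circleWeight (τ j) (m j) e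
  else ((taylorFactor (r j) (τ j) (m j) * hermiteFun (m j + τ j) e.1 : ℝ) : ℂ)

/-- The product weight which, in the coordinates `j ∈ S`, extracts the `m_j`-th Hermite coefficient
of the `τ_j`-th Taylor term, and in the coordinates `j ∉ S` the corresponding multiple of the
`(m_j + τ_j)`-th Hermite coefficient. -/
noncomputable def mixedWeight (r : Fin N → ℝ) (τ m : Fin N → ℕ) (S : Finset (Fin N))
    (x : Fin N → ℝ × ℝ) : ℂ :=
  ∏ j, mixedFactor r τ m S j (x j)

theorem mixedPoint_eq (r : Fin N → ℝ) (S : Finset (Fin N)) (x : Fin N → ℝ × ℝ) :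
    mixedPoint r S x = toComplex (fun j => (x j).1) +
      fun j => if j ∈ S then (r j : ℂ) * Complex.exp ((x j).2 * Complex.I) else 0 := by
  ext j
  simp only [mixedPoint, toComplex, circlePoint, Pi.add_apply]
  split_ifs <;> simp

theorem mixedOffset_mem_polydisc {r κ : Fin N → ℝ} (hr : ∀ j, 0 < r j) (hrκ : ∀ j, r j < κ j)
    (S : Finset (Fin N)) (x : Fin N → ℝ × ℝ) :
    (fun j => if j ∈ S then (r j : ℂ) * Complex.exp ((x j).2 * Complex.I) else 0) ∈
      polydisc κ := by
  intro j
  simp only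
  split_ifs
  · rw [norm_mul_exp_mul_I (hr j)]
    exact hrκ j
  · simpa using (hr j).trans (hrκ j)

theorem continuous_mixedPoint (r : Fin N → ℝ) (S : Finset (Fin N)) :
    Continuous (mixedPoint r S) := by
  refine continuous_pi fun j => ?_
  simp only [mixedPoint]
  split_ifs
  · exact (continuous_circlePoint _).comp (continuous_apply j)
  · fun_prop

theorem continuous_mixedFactor (r : Fin N → ℝ) (τ m : Fin N → ℕ) (S : Finset (Fin N))
    (j : Fin N) : Continuous (mixedFactor r τ m S j) := by
  unfold mixedFactor
  split_ifs
  · exact continuous_circleWeight _ _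
  · have := continuous_hermiteFun (m j + τ j)
    fun_prop

theorem continuous_mixedWeight (r : Fin N → ℝ) (τ m : Fin N → ℕ) (S : Finset (Fin N)) :
    Continuous (mixedWeight r τ m S) :=
  continuous_finsetProd _ fun j _ => (continuous_mixedFactor r τ m S j).comp (continuous_apply j)

theorem memLp_mixedFactor (r : Fin N → ℝ) (τ m : Fin N → ℕ) (S : Finset (Fin N)) (j : Fin N) :
    MemLp (mixedFactor r τ m S j) 2 gaussAngle := by
  have h (k : ℕ) : MemLp (fun e : ℝ × ℝ => hermiteFun k e.1) 2 gaussAngle :=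
    (memLp_hermiteFun k).comp_measurePreserving measurePreserving_fst_gaussAngle
  have hc := (continuous_mixedFactor r τ m S j).aestronglyMeasurable (μ := gaussAngle)
  by_cases hj : j ∈ S
  · refine (h (m j)).mono hc (ae_of_all _ fun e => ?_)
    rw [mixedFactor, if_pos hj, norm_circleWeight, Real.norm_eq_abs]
  · refine ((h (m j + τ j)).const_mul (taylorFactor (r j) (τ j) (m j))).mono hc
      (ae_of_all _ fun e => ?_)
    rw [mixedFactor, if_neg hj, Complex.norm_real]

theorem memLp_mixedWeight (r : Fin N → ℝ) (τ m : Fin N → ℕ) (S : Finset (Fin N)) :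
    MemLp (mixedWeight r τ m S) 2 (gaussAngleN N) := by
  have h := memLp_two_prod_pi (μ := fun _ : Fin N => gaussAngle)
    fun j => (memLp_mixedFactor r τ m S j).norm
  refine h.mono (continuous_mixedWeight r τ m S).aestronglyMeasurable (ae_of_all _ fun x => ?_)
  simp [mixedWeight]

variable {X : Type*} [NormedAddCommGroup X] [NormedSpace ℂ X]

theorem continuous_comp_mixedPoint {F : (Fin N → ℂ) → X} {r κ : Fin N → ℝ} (hr : ∀ j, 0 < r j)
    (hrκ : ∀ j, r j < κ j) (hF : DifferentiableOn ℂ F (strip κ)) (S : Finset (Fin N)) :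
    Continuous fun x => F (mixedPoint r S x) :=
  hF.continuousOn.comp_continuous (continuous_mixedPoint r S) fun x => by
    rw [mixedPoint_eq]
    exact toComplex_add_mem_strip _ (mixedOffset_mem_polydisc hr hrκ S x)

theorem memLp_comp_mixedPoint {F : (Fin N → ℂ) → X} {r κ : Fin N → ℝ} (hr : ∀ j, 0 < r j)
    (hrκ : ∀ j, r j < κ j) (hF : DifferentiableOn ℂ F (strip κ)) {φ : (Fin N → ℝ) → ℝ}
    (hφ : MemLp φ 2 (gaussN N))
    (hb : ∀ y : Fin N → ℝ, ∀ z ∈ polydisc κ, ‖F (toComplex y + z)‖ ≤ φ y) (S : Finset (Fin N)) :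
    MemLp (fun x => F (mixedPoint r S x)) 2 (gaussAngleN N) ∧
      eLpNorm (fun x => F (mixedPoint r S x)) 2 (gaussAngleN N) ≤ eLpNorm φ 2 (gaussN N) := by
  have hmp := measurePreserving_fst_gaussAngleN N
  have hle (x : Fin N → ℝ × ℝ) :
      ‖F (mixedPoint r S x)‖ ≤ ‖(φ ∘ fun x : Fin N → ℝ × ℝ => fun j => (x j).1) x‖ := by
    rw [mixedPoint_eq]
    exact (hb _ _ (mixedOffset_mem_polydisc hr hrκ S x)).trans (le_abs_self _)
  refine ⟨(hφ.comp_measurePreserving hmp).mono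
    (continuous_comp_mixedPoint hr hrκ hF S).aestronglyMeasurable (ae_of_all _ hle), ?_⟩
  rw [← eLpNorm_comp_measurePreserving hφ.1 hmp]
  exact eLpNorm_mono hle

theorem mixedWeight_update (r : Fin N → ℝ) (τ m : Fin N → ℕ) (S : Finset (Fin N)) (j : Fin N)
    (x : Fin N → ℝ × ℝ) (e : ℝ × ℝ) :
    mixedWeight r τ m S (Function.update x j e) = mixedFactor r τ m S j e *
      ∏ i ∈ Finset.univ.erase j, mixedFactor r τ m S i (x i) := by
  rw [mixedWeight, ← Finset.mul_prod_erase _ _ (Finset.mem_univ j), Function.update_self]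
  congr 1
  exact Finset.prod_congr rfl fun i hi => by rw [Function.update_of_ne (Finset.ne_of_mem_erase hi)]

theorem mixedFactor_insert_of_ne (r : Fin N → ℝ) (τ m : Fin N → ℕ) (S : Finset (Fin N))
    {i j : Fin N} (hij : i ≠ j) (e : ℝ × ℝ) :
    mixedFactor r τ m (insert j S) i e = mixedFactor r τ m S i e := by
  simp [mixedFactor, hij]

/-- Switching the coordinate `j` from extraction of a Hermite coefficient to extraction of a
Hermite coefficient of a Taylor term does not change the integral: for
fixed values of the other coordinates this is the one-variable identity. -/
theorem integral_mixed_insert [CompleteSpace X] {F : (Fin N → ℂ) → X} {r κ : Fin N → ℝ}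
    (hr : ∀ j, 0 < r j) (hrκ : ∀ j, r j < κ j) (hF : DifferentiableOn ℂ F (strip κ))
    {φ : (Fin N → ℝ) → ℝ} (hφ : MemLp φ 2 (gaussN N))
    (hb : ∀ y : Fin N → ℝ, ∀ z ∈ polydisc κ, ‖F (toComplex y + z)‖ ≤ φ y)
    (τ m : Fin N → ℕ) {S : Finset (Fin N)} {j : Fin N} (hj : j ∉ S) :
    ∫ x, mixedWeight r τ m (insert j S) x • F (mixedPoint r (insert j S) x) ∂gaussAngleN N =
      ∫ x, mixedWeight r τ m S x • F (mixedPoint r S x) ∂gaussAngleN N := by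
  have hint (T : Finset (Fin N)) : Integrable
      (fun x => mixedWeight r τ m T x • F (mixedPoint r T x)) (gaussAngleN N) :=
    memLp_one_iff_integrable.1
      ((memLp_comp_mixedPoint hr hrκ hF hφ hb T).1.smul (memLp_mixedWeight r τ m T))
  -- For almost all values of the other coordinates, the bound `φ` is square integrable in the
  -- coordinate `j`, as the one-variable identity requires.
  have hslice : ∀ᵐ x ∂gaussAngleN N,
      MemLp (fun s => φ (Function.update (fun i => (x i).1) j s)) 2 (gaussianReal 0 1) := by
    have hφ' := hφ.comp_measurePreserving
      (measurePreserving_update_prod (fun _ : Fin N => gaussianReal 0 1) j)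
    have h1 := hφ'.1.prodMk_left
    have h2 := hφ'.integrable_sq.prod_right_ae
    have h3 : ∀ᵐ y ∂gaussN N, MemLp (fun s => φ (Function.update y j s)) 2 (gaussianReal 0 1) := by
      filter_upwards [h1, h2] with y hy1 hy2
      exact (memLp_two_iff_integrable_sq hy1).2 hy2
    exact (measurePreserving_fst_gaussAngleN N).quasiMeasurePreserving.ae h3
  have hu (T : Finset (Fin N)) := integral_pi_eq_integral_update
    (fun _ : Fin N => gaussAngle) j (hint T)
  unfold gaussAngleN at *
  rw [hu, hu]
  refine integral_congr_ae ?_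
  filter_upwards [hslice] with x hx
  set p : Fin N → ℂ := mixedPoint r S x with hp
  have hp1 (e : ℝ × ℝ) : mixedPoint r (insert j S) (Function.update x j e) =
      Function.update p j (circlePoint (r j) e) := by
    ext i
    rcases eq_or_ne i j with rfl | hij
    · simp [mixedPoint]
    · simp [mixedPoint, hij, hp]
  have hp2 (e : ℝ × ℝ) : mixedPoint r S (Function.update x j e) =
      Function.update p j (e.1 : ℂ) := by
    ext i
    rcases eq_or_ne i j with rfl | hij
    · simp [mixedPoint, hj]
    · simp [mixedPoint, hij, hp]
  set P : ℂ := ∏ i ∈ Finset.univ.erase j, mixedFactor r τ m S i (x i) with hP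
  have hP' : ∏ i ∈ Finset.univ.erase j, mixedFactor r τ m (insert j S) i (x i) = P :=
    Finset.prod_congr rfl fun i hi => mixedFactor_insert_of_ne r τ m S (Finset.ne_of_mem_erase hi) _
  have hκ (i : Fin N) := (hr i).trans (hrκ i)
  have hgd : DifferentiableOn ℂ (fun z => F (Function.update p j z)) {z | |z.im| < κ j} := by
    refine hF.comp (t := strip κ) ?_ ?_
    · exact fun z _ => (hasFDerivAt_update (𝕜 := ℂ) p z).differentiableAt.differentiableWithinAt
    · intro z hz i
      rcases eq_or_ne i j with rfl | hij
      · simpa using hz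
      · rw [Function.update_of_ne hij, hp, mixedPoint_eq]
        exact toComplex_add_mem_strip _ (mixedOffset_mem_polydisc hr hrκ S x) i
  have hgb (s : ℝ) (ζ : ℂ) (hζ : ‖ζ‖ < κ j) : ‖F (Function.update p j (s + ζ))‖ ≤
      φ (Function.update (fun i => (x i).1) j s) := by
    have := hb (Function.update (fun i => (x i).1) j s) (Function.update (fun i =>
      if i ∈ S then (r i : ℂ) * Complex.exp ((x i).2 * Complex.I) else 0) j ζ) (fun i => by
        rcases eq_or_ne i j with rfl | hij
        · simpa using hζ
        · rw [Function.update_of_ne hij]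
          exact mixedOffset_mem_polydisc hr hrκ S x i)
    convert this using 3
    ext i
    rcases eq_or_ne i j with rfl | hij
    · simp [toComplex]
    · rw [Function.update_of_ne hij, hp, mixedPoint_eq]
      simp [toComplex, hij]
  have key := integral_circleWeight_smul (hr j) (hrκ j) hgd hx hgb (τ j) (m j)
  simp only [mixedWeight_update, hp1, hp2, hP', ← hP, mul_comm _ P, mul_smul]
  rw [integral_smul, integral_smul]
  congr 1
  simpa [mixedFactor, hj] using key

/-- The Hermite coefficient of index `m` of the Taylor term of index `τ` of `F` is, up to an
explicit factor, the Hermite coefficient of index `m + τ` of `F`. -/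
theorem integral_taylor_eq_hermiteCoeffN [CompleteSpace X] {F : (Fin N → ℂ) → X}
    {r κ : Fin N → ℝ} (hr : ∀ j, 0 < r j) (hrκ : ∀ j, r j < κ j)
    (hF : DifferentiableOn ℂ F (strip κ)) {φ : (Fin N → ℝ) → ℝ} (hφ : MemLp φ 2 (gaussN N))
    (hb : ∀ y : Fin N → ℝ, ∀ z ∈ polydisc κ, ‖F (toComplex y + z)‖ ≤ φ y) (τ m : Fin N → ℕ) :
    ∫ x, mixedWeight r τ m Finset.univ x • F (mixedPoint r Finset.univ x) ∂gaussAngleN N =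
      ((∏ j, taylorFactor (r j) (τ j) (m j) : ℝ) : ℂ) •
        hermiteCoeffN (fun y => F (toComplex y)) (m + τ) := by
  have h (S : Finset (Fin N)) :
      ∫ x, mixedWeight r τ m S x • F (mixedPoint r S x) ∂gaussAngleN N =
        ∫ x, mixedWeight r τ m ∅ x • F (mixedPoint r ∅ x) ∂gaussAngleN N := by
    induction S using Finset.induction_on with
    | empty => rfl
    | insert j S hj ih => rw [integral_mixed_insert hr hrκ hF hφ hb τ m hj, ih]
  have hmp := measurePreserving_fst_gaussAngleN N
  set f : (Fin N → ℝ) → X := fun y =>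
    ((∏ j, hermiteFun (m j + τ j) (y j) : ℝ) : ℂ) • F (toComplex y) with hf
  have hfc : Continuous f := by
    have hFc : Continuous fun y : Fin N → ℝ => F (toComplex y) :=
      hF.continuousOn.comp_continuous (by unfold toComplex; fun_prop) fun y i => by
        simpa [toComplex] using (hr i).trans (hrκ i)
    have : Continuous fun y : Fin N → ℝ => ∏ j, hermiteFun (m j + τ j) (y j) :=
      continuous_finsetProd _ fun j _ => (continuous_hermiteFun _).comp (continuous_apply j)
    exact (Complex.continuous_ofReal.comp this).smul hFc
  have hcoeff : hermiteCoeffN (fun y => F (toComplex y)) (m + τ) =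
      ∫ x, f (fun j => (x j).1) ∂gaussAngleN N := by
    rw [← integral_map hmp.measurable.aemeasurable hfc.aestronglyMeasurable, hmp.map_eq]
    rfl
  rw [h, hcoeff, ← integral_smul]
  refine integral_congr_ae (ae_of_all _ fun x => ?_)
  have hx : mixedPoint r ∅ x = toComplex fun j => (x j).1 := by
    ext j
    simp [mixedPoint, toComplex]
  simp only [hf, hx, smul_smul, mixedWeight, mixedFactor, Finset.notMem_empty, if_false]
  rw [← Complex.ofReal_prod, Finset.prod_mul_distrib, Complex.ofReal_mul]

end Tensor

theorem integral_mixedWeight_mul_conj {N : ℕ} (r : Fin N → ℝ) (τ m n : Fin N → ℕ) :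
    ∫ x, mixedWeight r τ m Finset.univ x * (starRingEnd ℂ) (mixedWeight r τ n Finset.univ x)
        ∂gaussAngleN N = if m = n then 1 else 0 := by
  simp only [mixedWeight, map_prod, ← Finset.prod_mul_distrib]
  rw [gaussAngleN, integral_fintype_prod_eq_prod (f := fun j e =>
    mixedFactor r τ m Finset.univ j e * (starRingEnd ℂ) (mixedFactor r τ n Finset.univ j e))]
  simp only [mixedFactor, Finset.mem_univ, if_true, integral_circleWeight_mul_conj]
  split_ifs with h
  · exact Finset.prod_eq_one fun j _ => by rw [h, if_pos rfl]
  · obtain ⟨j, hj⟩ := Function.ne_iff.1 h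
    exact Finset.prod_eq_zero (Finset.mem_univ j) (if_neg hj)

/-- The weighted Bessel inequality: the Taylor term of index `τ` on the polycircle of radii `r`
is bounded by `φ`, and its Hermite coefficients are multiples of those of `F`. -/
theorem sum_choose_mul_norm_hermiteCoeffN_sq_le {N : ℕ} {X : Type*} [NormedAddCommGroup X]
    [InnerProductSpace ℂ X] [CompleteSpace X] {F : (Fin N → ℂ) → X}
    {r κ : Fin N → ℝ} (hr : ∀ j, 0 < r j) (hrκ : ∀ j, r j < κ j)
    (hF : DifferentiableOn ℂ F (strip κ)) {φ : (Fin N → ℝ) → ℝ} (hφ : MemLp φ 2 (gaussN N))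
    (hb : ∀ y : Fin N → ℝ, ∀ z ∈ polydisc κ, ‖F (toComplex y + z)‖ ≤ φ y)
    {δ : ℝ} (hδ : 0 ≤ δ) (hφδ : eLpNorm φ 2 (gaussN N) ≤ ENNReal.ofReal δ)
    (τ : Fin N → ℕ) (A : Finset (Fin N → ℕ)) :
    ∑ ν ∈ A, (∏ j, ((ν j).choose (τ j) : ℝ)) *
        ‖hermiteCoeffN (fun y => F (toComplex y)) ν‖ ^ 2 ≤
      (∏ j, ((τ j).factorial : ℝ) / r j ^ (2 * τ j)) * δ ^ 2 := by
  classical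
  obtain ⟨hf, hfle⟩ := memLp_comp_mixedPoint hr hrκ hF hφ hb Finset.univ
  have hle : (eLpNorm (fun x => F (mixedPoint r Finset.univ x)) 2 (gaussAngleN N)).toReal ≤ δ :=
    ENNReal.toReal_le_of_le_ofReal hδ (hfle.trans hφδ)
  have hB := sum_norm_integral_smul_sq_le (A.filter (τ ≤ ·))
    (K := fun ν => mixedWeight r τ (ν - τ) Finset.univ)
    (fun ν _ => memLp_mixedWeight r τ (ν - τ) Finset.univ) (fun ν hν ν' hν' => by
      rw [integral_mixedWeight_mul_conj]
      have h1 := (Finset.mem_filter.1 hν).2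
      have h2 := (Finset.mem_filter.1 hν').2
      congr 1
      rw [tsub_left_inj h1 h2]) hf
  replace hB := hB.trans (pow_le_pow_left₀ ENNReal.toReal_nonneg hle 2)
  have hpos : 0 < ∏ j, ((τ j).factorial : ℝ) / r j ^ (2 * τ j) :=
    Finset.prod_pos fun j _ => div_pos (by positivity) (pow_pos (hr j) _)
  calc ∑ ν ∈ A, (∏ j, ((ν j).choose (τ j) : ℝ)) *
        ‖hermiteCoeffN (fun y => F (toComplex y)) ν‖ ^ 2
      = ∑ ν ∈ A.filter (τ ≤ ·), (∏ j, ((ν j).choose (τ j) : ℝ)) *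
        ‖hermiteCoeffN (fun y => F (toComplex y)) ν‖ ^ 2 := by
        refine (Finset.sum_filter_of_ne fun ν _ h => ?_).symm
        by_contra hlt
        obtain ⟨j, hj⟩ := not_forall.1 hlt
        refine h (mul_eq_zero_of_left (Finset.prod_eq_zero (Finset.mem_univ j) ?_) _)
        simpa using Nat.choose_eq_zero_of_lt (not_le.1 hj)
    _ = ∑ ν ∈ A.filter (τ ≤ ·), (∏ j, ((τ j).factorial : ℝ) / r j ^ (2 * τ j)) *
        ‖∫ x, mixedWeight r τ (ν - τ) Finset.univ x • F (mixedPoint r Finset.univ x)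
          ∂gaussAngleN N‖ ^ 2 := by
        refine Finset.sum_congr rfl fun ν hν => ?_
        have h1 := (Finset.mem_filter.1 hν).2
        rw [integral_taylor_eq_hermiteCoeffN hr hrκ hF hφ hb, tsub_add_cancel_of_le h1, norm_smul,
          mul_pow, Complex.norm_real, Real.norm_eq_abs, sq_abs, ← Finset.prod_pow, ← mul_assoc,
          ← Finset.prod_mul_distrib]
        congr 1
        refine Finset.prod_congr rfl fun j _ => ?_
        rw [taylorFactor_sq, Pi.sub_apply, Nat.sub_add_cancel (h1 j)]
        have := hr j
        field_simp
    _ ≤ _ := by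
        rw [← Finset.mul_sum]
        exact mul_le_mul_of_nonneg_left hB hpos.le

/-! ### Choice of the radii and summation over the orders of the Taylor terms -/

/-- Grouping by `n = |τ|`, the multinomial theorem bounds the sum by `∑_n 2^{-n}`. -/
theorem sum_multinomial_mul_prod_pow_le {N : ℕ} {a : Fin N → ℝ} (ha : ∀ j, 0 ≤ a j)
    (ha1 : ∑ j, a j ≤ 1) (T : Finset (Fin N → ℕ)) :
    ∑ τ ∈ T, (1 / 2 : ℝ) ^ (∑ j, τ j) *
      ((Nat.multinomial Finset.univ τ : ℝ) * ∏ j, a j ^ τ j) ≤ 2 := by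
  classical
  calc ∑ τ ∈ T, (1 / 2 : ℝ) ^ (∑ j, τ j) *
        ((Nat.multinomial Finset.univ τ : ℝ) * ∏ j, a j ^ τ j)
      = ∑ n ∈ T.image fun τ => ∑ j, τ j, ∑ τ ∈ T with ∑ j, τ j = n, (1 / 2 : ℝ) ^ (∑ j, τ j) *
        ((Nat.multinomial Finset.univ τ : ℝ) * ∏ j, a j ^ τ j) :=
        (Finset.sum_fiberwise_of_maps_to (fun τ hτ => Finset.mem_image_of_mem _ hτ) _).symm
    _ ≤ ∑ n ∈ T.image fun τ => ∑ j, τ j, (1 / 2 : ℝ) ^ n := by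
        refine Finset.sum_le_sum fun n _ => ?_
        calc ∑ τ ∈ T with ∑ j, τ j = n, (1 / 2 : ℝ) ^ (∑ j, τ j) *
              ((Nat.multinomial Finset.univ τ : ℝ) * ∏ j, a j ^ τ j)
            = ∑ τ ∈ T with ∑ j, τ j = n, (1 / 2 : ℝ) ^ n *
              ((Nat.multinomial Finset.univ τ : ℝ) * ∏ j, a j ^ τ j) :=
              Finset.sum_congr rfl fun τ hτ => by rw [(Finset.mem_filter.1 hτ).2]
          _ ≤ ∑ τ ∈ Finset.piAntidiag Finset.univ n, (1 / 2 : ℝ) ^ n *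
              ((Nat.multinomial Finset.univ τ : ℝ) * ∏ j, a j ^ τ j) := by
              refine Finset.sum_le_sum_of_subset_of_nonneg (fun τ hτ => ?_) fun τ _ _ => ?_
              · simpa using (Finset.mem_filter.1 hτ).2
              · have := Finset.prod_nonneg fun j (_ : j ∈ Finset.univ) => pow_nonneg (ha j) (τ j)
                positivity
          _ = (1 / 2 : ℝ) ^ n * (∑ j, a j) ^ n := by
              rw [← Finset.mul_sum, Finset.sum_pow_eq_sum_piAntidiag]
          _ ≤ (1 / 2 : ℝ) ^ n :=
              mul_le_of_le_one_right (by positivity)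
                (pow_le_one₀ (Finset.sum_nonneg fun j _ => ha j) ha1)
    _ ≤ 2 := sum_le_hasSum _ (fun n _ => by positivity) hasSum_geometric_two

/-- The radius in the coordinate `j` for the Taylor term of index `τ`. Up to a constant,
`r_j² b_j²` is `τ_j / |τ|`, which makes the bound `τ! r^{-2τ}` small under the constraint of
admissibility; the summand `1 / N` keeps the radii positive where `τ_j = 0`. -/
noncomputable def taylorRadius {N : ℕ} (b : ℕ → ℝ) (ξ : ℝ) (τ : Fin N → ℕ) (j : Fin N) : ℝ :=
  ξ / (2 * b j) * √((τ j : ℝ) / (∑ i, τ i : ℕ) + 1 / N)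

section Radius

variable {N : ℕ} {b : ℕ → ℝ} {ξ : ℝ}

theorem taylorRadius_pos (hb : ∀ j, 0 < b j) (hξ : 0 < ξ) (τ : Fin N → ℕ) (j : Fin N) :
    0 < taylorRadius b ξ τ j := by
  have := hb j
  have hN : (0 : ℝ) < N := by exact_mod_cast j.pos
  unfold taylorRadius
  positivity

theorem taylorRadius_sq (hb : ∀ j, 0 < b j) (τ : Fin N → ℕ) (j : Fin N) :
    b j ^ 2 * taylorRadius b ξ τ j ^ 2 =
      ξ ^ 2 / 4 * ((τ j : ℝ) / (∑ i, τ i : ℕ) + 1 / N) := by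
  have := hb j
  rw [taylorRadius, mul_pow, Real.sq_sqrt (by positivity)]
  field_simp
  ring

theorem isAdmissible_sqrt_two_mul_taylorRadius (hb : ∀ j, 0 < b j) (hξ : 0 < ξ) (τ : Fin N → ℕ) :
    IsAdmissible b ξ 2 fun j => √2 * taylorRadius b ξ τ j := by
  refine ⟨fun j => mul_pos (by positivity) (taylorRadius_pos hb hξ τ j), fun _ => ?_, by simp⟩
  have h2 (j : Fin N) : b j ^ 2 * (√2 * taylorRadius b ξ τ j) ^ 2 =
      ξ ^ 2 / 2 * ((τ j : ℝ) / (∑ i, τ i : ℕ) + 1 / N) := by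
    rw [mul_pow, Real.sq_sqrt zero_le_two, mul_left_comm, taylorRadius_sq hb]
    ring
  simp only [ENNReal.toReal_ofNat, Real.rpow_ofNat, h2]
  rw [← Finset.mul_sum, Finset.sum_add_distrib, ← Finset.sum_div, ← Nat.cast_sum]
  have h3 : ((∑ i, τ i : ℕ) : ℝ) / (∑ i, τ i : ℕ) ≤ 1 := div_self_le_one _
  have h4 : ∑ _j : Fin N, (1 : ℝ) / N ≤ 1 := by
    simpa using mul_inv_le_one (a := (N : ℝ))
  nlinarith [sq_nonneg ξ]

/-- The contribution of one coordinate. Of the constant `8 e M!` in the choice of `ϱ`, a factor `4`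
compensates the radii, `M!` the bound `τ_j! ≤ M!^{τ_j}`, `e` the later use of `n^n ≤ e^n n!`, and
the remaining factor `2` yields the geometric series. -/
theorem factorial_mul_pow_div_taylorRadius_le (hb : ∀ j, 0 < b j) (hξ : 0 < ξ) {M : ℕ}
    {ϱ a : ℕ → ℝ} (hϱ : ∀ j, ϱ j ^ 2 * b j ^ 2 =
      a j * (ξ ^ 2 / (8 * Real.exp 1 * (M.factorial : ℝ)))) (ha : ∀ j, 0 ≤ a j)
    {τ : Fin N → ℕ} {j : Fin N} (hτ : τ j ≤ M) :
    (τ j).factorial / taylorRadius b ξ τ j ^ (2 * τ j) * ϱ j ^ (2 * τ j) ≤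
      a j ^ τ j * ((∑ i, τ i : ℕ) / (2 * Real.exp 1)) ^ τ j / (τ j).factorial := by
  rcases Nat.eq_zero_or_pos (τ j) with h0 | hpos
  · simp [h0]
  have hbj := hb j
  have hr := taylorRadius_pos hb hξ τ j
  set n : ℕ := ∑ i, τ i with hn
  set k : ℕ := τ j with hk
  have hkn : k ≤ n := Finset.single_le_sum (f := τ) (fun _ _ => Nat.zero_le _) (Finset.mem_univ j)
  have hn0 : (0 : ℝ) < n := by exact_mod_cast hpos.trans_le hkn
  have hk0 : (0 : ℝ) < k := by exact_mod_cast hpos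
  have hM0 : (0 : ℝ) < M.factorial := by positivity
  have hratio : ϱ j ^ 2 / taylorRadius b ξ τ j ^ 2 ≤
      a j * (n / (2 * Real.exp 1)) / (M.factorial * k) := by
    have h1 : ξ ^ 2 / 4 * (k / n) ≤ b j ^ 2 * taylorRadius b ξ τ j ^ 2 := by
      rw [taylorRadius_sq hb]
      gcongr
      exact le_add_of_nonneg_right (by positivity)
    have h2 : ϱ j ^ 2 / taylorRadius b ξ τ j ^ 2 =
        (ϱ j ^ 2 * b j ^ 2) / (b j ^ 2 * taylorRadius b ξ τ j ^ 2) := by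
      field_simp
    rw [h2, hϱ]
    calc a j * (ξ ^ 2 / (8 * Real.exp 1 * M.factorial)) / (b j ^ 2 * taylorRadius b ξ τ j ^ 2)
        ≤ a j * (ξ ^ 2 / (8 * Real.exp 1 * M.factorial)) / (ξ ^ 2 / 4 * (k / n)) := by
          have := ha j
          gcongr
      _ = _ := by
          field_simp
          ring
  have hfac : ((k.factorial : ℝ)) ^ 2 ≤ (M.factorial * k) ^ k := by
    rw [mul_pow, sq]
    have h1 : (k.factorial : ℝ) ≤ (M.factorial : ℝ) ^ k := by
      have : (k.factorial : ℝ) ≤ M.factorial := by exact_mod_cast Nat.factorial_le hτ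
      exact this.trans (le_self_pow₀ (by exact_mod_cast M.factorial_pos) hpos.ne')
    have h2 : (k.factorial : ℝ) ≤ (k : ℝ) ^ k := by exact_mod_cast Nat.factorial_le_pow k
    gcongr
  have haj := ha j
  have hfp : (0 : ℝ) < k.factorial := by positivity
  calc k.factorial / taylorRadius b ξ τ j ^ (2 * k) * ϱ j ^ (2 * k)
      = k.factorial * (ϱ j ^ 2 / taylorRadius b ξ τ j ^ 2) ^ k := by
        rw [div_pow, pow_mul, pow_mul]
        ring
    _ ≤ k.factorial * (a j * (n / (2 * Real.exp 1)) / (M.factorial * k)) ^ k := by gcongr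
    _ = a j ^ k * (n / (2 * Real.exp 1)) ^ k * k.factorial / (M.factorial * k) ^ k := by
        rw [div_pow, mul_pow]
        ring
    _ ≤ a j ^ k * (n / (2 * Real.exp 1)) ^ k * k.factorial / (k.factorial : ℝ) ^ 2 := by gcongr
    _ = _ := by field_simp

theorem prod_factorial_mul_pow_div_taylorRadius_le (hb : ∀ j, 0 < b j) (hξ : 0 < ξ) {M : ℕ}
    {ϱ a : ℕ → ℝ} (hϱ : ∀ j, ϱ j ^ 2 * b j ^ 2 =
      a j * (ξ ^ 2 / (8 * Real.exp 1 * (M.factorial : ℝ)))) (ha : ∀ j, 0 ≤ a j)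
    (hϱ0 : ∀ j, 0 < ϱ j) {τ : Fin N → ℕ} (hτ : ∀ j, τ j ≤ M) :
    (∏ j, ((τ j).factorial : ℝ) / taylorRadius b ξ τ j ^ (2 * τ j)) * ∏ j : Fin N, ϱ j ^ (2 * τ j) ≤
      (1 / 2 : ℝ) ^ (∑ j, τ j) *
        ((Nat.multinomial Finset.univ τ : ℝ) * ∏ j : Fin N, a j ^ τ j) := by
  set n : ℕ := ∑ i, τ i with hn
  rw [← Finset.prod_mul_distrib]
  have hmul : (Nat.multinomial Finset.univ τ : ℝ) = n.factorial / ∏ j, ((τ j).factorial : ℝ) := by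
    rw [eq_div_iff (Finset.prod_ne_zero_iff.2 fun j _ => by positivity), mul_comm]
    exact_mod_cast Nat.multinomial_spec Finset.univ τ
  have hnn : ((n : ℝ) / (2 * Real.exp 1)) ^ n ≤ (1 / 2) ^ n * n.factorial := by
    have h := Real.pow_div_factorial_le_exp (n : ℝ) (by positivity) n
    rw [div_le_iff₀ (by positivity)] at h
    have h1 : Real.exp n = Real.exp 1 ^ n := by rw [← Real.exp_nat_mul, mul_one]
    rw [h1] at h
    calc ((n : ℝ) / (2 * Real.exp 1)) ^ n = (1 / 2) ^ n * ((n : ℝ) ^ n / Real.exp 1 ^ n) := by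
          rw [← div_pow, ← mul_pow]; congr 1; field_simp
      _ ≤ (1 / 2) ^ n * n.factorial := by
          gcongr
          rw [div_le_iff₀ (by positivity)]
          linarith
  calc ∏ j : Fin N, (((τ j).factorial : ℝ) / taylorRadius b ξ τ j ^ (2 * τ j) * ϱ j ^ (2 * τ j))
      ≤ ∏ j : Fin N, (a j ^ τ j * ((n : ℝ) / (2 * Real.exp 1)) ^ τ j / (τ j).factorial) := by
        refine Finset.prod_le_prod (fun j _ => ?_) fun j _ =>
          factorial_mul_pow_div_taylorRadius_le hb hξ hϱ ha (hτ j)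
        have := taylorRadius_pos hb hξ τ j
        have := hϱ0 j
        positivity
    _ = ((n : ℝ) / (2 * Real.exp 1)) ^ n *
          ((∏ j : Fin N, a j ^ τ j) / ∏ j, ((τ j).factorial : ℝ)) := by
        rw [Finset.prod_div_distrib, Finset.prod_mul_distrib, Finset.prod_pow_eq_pow_sum]
        ring
    _ ≤ ((1 / 2) ^ n * n.factorial) *
          ((∏ j : Fin N, a j ^ τ j) / ∏ j, ((τ j).factorial : ℝ)) := by
        have := Finset.prod_nonneg fun j (_ : j ∈ Finset.univ) => pow_nonneg (ha (j : Fin N)) (τ j)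
        have := Finset.prod_nonneg fun j (_ : j ∈ Finset.univ) =>
          (Nat.cast_nonneg (α := ℝ) (τ j).factorial)
        gcongr
    _ = _ := by
        rw [hmul]
        ring

end Radius

/-! ### The weighted bound in finitely many variables -/

section FiniteDim

variable {X : Type*} [NormedAddCommGroup X] [InnerProductSpace ℂ X]
  {u : (ℕ → ℝ) → X} {b : ℕ → ℝ} {ξ δ : ℝ} {v : (N : ℕ) → (Fin N → ℝ) → X}

theorem IsHolomorphicFamily.continuous (hv : IsHolomorphicFamily u b ξ 2 δ v)
    (hb : ∀ j, 0 < b j) (hξ : 0 < ξ) {N : ℕ} (hN : 1 ≤ N) : Continuous (v N) := by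
  have hadm := isAdmissible_sqrt_two_mul_taylorRadius hb hξ (0 : Fin N → ℕ)
  obtain ⟨F, hF, hFv⟩ := hv.extends_hol N hN _ hadm
  rw [← funext hFv]
  exact hF.continuousOn.comp_continuous (by unfold toComplex; fun_prop) fun y i => by
    simpa [toComplex] using hadm.1 i

theorem IsHolomorphicFamily.memLp (hv : IsHolomorphicFamily u b ξ 2 δ v)
    (hb : ∀ j, 0 < b j) (hξ : 0 < ξ) {N : ℕ} (hN : 1 ≤ N) : MemLp (v N) 2 (gaussN N) := by
  have hadm := isAdmissible_sqrt_two_mul_taylorRadius hb hξ (0 : Fin N → ℕ)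
  obtain ⟨F, hF⟩ := hv.extends_hol N hN _ hadm
  obtain ⟨φ, -, hφ, -, hle⟩ := hv.bounded N hN
  refine hφ.mono (hv.continuous hb hξ hN).aestronglyMeasurable (ae_of_all _ fun y => ?_)
  have := hle _ hadm F hF y 0 fun i => by simpa using hadm.1 i
  rw [add_zero, hF.2] at this
  exact this.trans (le_abs_self _)

/-- The bound `∑_ν β_ν ‖v_ν‖² ≤ 2 δ²` for the finite-dimensional approximations: expand the weight
over `τ ≤ M` and apply the weighted Bessel inequality for each `τ` with its own radii. -/
theorem sum_prod_mul_norm_hermiteCoeffN_sq_le [CompleteSpace X]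
    (hv : IsHolomorphicFamily u b ξ 2 δ v) (hb : ∀ j, 0 < b j) (hξ : 0 < ξ) (hδ : 0 < δ) {M : ℕ}
    {ϱ a : ℕ → ℝ} (hϱ : ∀ j, ϱ j ^ 2 * b j ^ 2 =
      a j * (ξ ^ 2 / (8 * Real.exp 1 * (M.factorial : ℝ)))) (ha : ∀ j, 0 ≤ a j)
    (hϱ0 : ∀ j, 0 < ϱ j) {N : ℕ} (hN : 1 ≤ N) (ha1 : ∑ j : Fin N, a j ≤ 1)
    (A : Finset (Fin N → ℕ)) :
    ∑ ν ∈ A, (∏ j : Fin N, ∑ l ∈ Finset.range (M + 1), ((ν j).choose l : ℝ) * ϱ j ^ (2 * l)) *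
      ‖hermiteCoeffN (v N) ν‖ ^ 2 ≤ 2 * δ ^ 2 := by
  obtain ⟨φ, -, hφ, hφδ, hle⟩ := hv.bounded N hN
  set T := Fintype.piFinset fun _ : Fin N => Finset.range (M + 1) with hT
  have hone (τ : Fin N → ℕ) : ∑ ν ∈ A, (∏ j, ((ν j).choose (τ j) : ℝ)) *
      ‖hermiteCoeffN (v N) ν‖ ^ 2 ≤
        (∏ j, ((τ j).factorial : ℝ) / taylorRadius b ξ τ j ^ (2 * τ j)) * δ ^ 2 := by
    have hadm := isAdmissible_sqrt_two_mul_taylorRadius hb hξ τ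
    obtain ⟨F, hF⟩ := hv.extends_hol N hN _ hadm
    have := sum_choose_mul_norm_hermiteCoeffN_sq_le (taylorRadius_pos hb hξ τ) (fun j => by
      have := taylorRadius_pos hb hξ τ j
      have h2 : 1 < √2 := Real.one_lt_sqrt_two
      nlinarith) hF.1 hφ (hle _ hadm F hF) hδ.le hφδ τ A
    rwa [funext hF.2] at this
  calc ∑ ν ∈ A, (∏ j : Fin N, ∑ l ∈ Finset.range (M + 1), ((ν j).choose l : ℝ) * ϱ j ^ (2 * l)) *
        ‖hermiteCoeffN (v N) ν‖ ^ 2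
      = ∑ τ ∈ T, (∏ j : Fin N, ϱ j ^ (2 * τ j)) * ∑ ν ∈ A, (∏ j, ((ν j).choose (τ j) : ℝ)) *
        ‖hermiteCoeffN (v N) ν‖ ^ 2 := by
        simp only [Finset.prod_univ_sum, Finset.sum_mul, Finset.mul_sum]
        rw [Finset.sum_comm]
        refine Finset.sum_congr rfl fun τ _ => Finset.sum_congr rfl fun ν _ => ?_
        rw [Finset.prod_mul_distrib]
        ring
    _ ≤ ∑ τ ∈ T, (1 / 2 : ℝ) ^ (∑ j, τ j) *
        ((Nat.multinomial Finset.univ τ : ℝ) * ∏ j : Fin N, a j ^ τ j) * δ ^ 2 := by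
        refine Finset.sum_le_sum fun τ hτ => ?_
        have hϱp : 0 ≤ ∏ j : Fin N, ϱ j ^ (2 * τ j) :=
          Finset.prod_nonneg fun j _ => pow_nonneg (hϱ0 j).le _
        have hτM (j : Fin N) : τ j ≤ M := by
          have := Fintype.mem_piFinset.1 hτ j
          rw [Finset.mem_range] at this
          omega
        refine (mul_le_mul_of_nonneg_left (hone τ) hϱp).trans ?_
        rw [← mul_assoc, mul_comm (∏ j : Fin N, ϱ j ^ (2 * τ j))]
        exact mul_le_mul_of_nonneg_right
          (prod_factorial_mul_pow_div_taylorRadius_le hb hξ hϱ ha hϱ0 hτM) (sq_nonneg δ)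
    _ ≤ 2 * δ ^ 2 := by
        rw [← Finset.sum_mul]
        exact mul_le_mul_of_nonneg_right
          (sum_multinomial_mul_prod_pow_le (fun j => ha j) ha1 T) (sq_nonneg δ)

end FiniteDim

/-! ### Passage to infinitely many variables -/

instance : IsProbabilityMeasure gaussInf := by
  unfold gaussInf; infer_instance

theorem measurePreserving_gaussInf_gaussN (N : ℕ) :
    MeasurePreserving (fun (y : ℕ → ℝ) (i : Fin N) => y i) gaussInf (gaussN N) := by
  have hm : Measurable fun (y : ℕ → ℝ) (i : Fin N) => y i := by fun_prop
  refine ⟨hm, (Measure.pi_eq fun s hs => ?_).symm⟩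
  rw [Measure.map_apply hm (MeasurableSet.univ_pi hs)]
  have h : (fun (y : ℕ → ℝ) (i : Fin N) => y i) ⁻¹' Set.univ.pi s =
      Set.pi (Finset.range N) fun i => if h : i < N then s ⟨i, h⟩ else Set.univ := by
    ext y
    simp only [Set.mem_preimage, Set.mem_pi, Finset.coe_range, Set.mem_Iio]
    constructor
    · intro h i hi
      simpa [hi] using h ⟨i, hi⟩
    · intro h i
      simpa using h i i.2
  rw [h, gaussInf, Measure.infinitePi_pi, Finset.prod_range]
  · simp
  · intro i hi
    rw [dif_pos (Finset.mem_range.1 hi)]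
    exact hs _

theorem hermiteFun_zero (x : ℝ) : hermiteFun 0 x = 1 := by
  simp [hermiteFun]

theorem prod_support_eq_prod_fin {R : Type*} [CommMonoid R] {f : ℕ → ℕ → R}
    (hf : ∀ j, f j 0 = 1) {ν : ℕ →₀ ℕ} {N : ℕ} (hν : ν.support ⊆ Finset.range N) :
    ∏ j ∈ ν.support, f j (ν j) = ∏ j : Fin N, f j (ν j) := by
  rw [← Finset.prod_range fun j => f j (ν j)]
  refine Finset.prod_subset hν fun j _ hj => ?_
  rw [Finsupp.notMem_support_iff.1 hj, hf]

theorem hermiteMulti_eq_prod_fin {ν : ℕ →₀ ℕ} {N : ℕ} (hν : ν.support ⊆ Finset.range N)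
    (y : ℕ → ℝ) : hermiteMulti ν y = ∏ j : Fin N, hermiteFun (ν j) (y j) :=
  prod_support_eq_prod_fin (f := fun j k => hermiteFun k (y j)) (fun _ => hermiteFun_zero _) hν

theorem betaWeight_eq_prod_fin (M : ℕ) (ϱ : ℕ → ℝ) {ν : ℕ →₀ ℕ} {N : ℕ}
    (hν : ν.support ⊆ Finset.range N) :
    betaWeight M ϱ ν =
      ∏ j : Fin N, ∑ l ∈ Finset.range (M + 1), ((ν j).choose l : ℝ) * ϱ j ^ (2 * l) := by
  refine prod_support_eq_prod_fin (f := fun j k =>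
    ∑ l ∈ Finset.range (M + 1), (k.choose l : ℝ) * ϱ j ^ (2 * l)) (fun j => ?_) hν
  rw [Finset.sum_range_succ']
  simp

theorem exists_support_subset_range (A : Finset (ℕ →₀ ℕ)) :
    ∃ N, ∀ n, N ≤ n → ∀ ν ∈ A, ν.support ⊆ Finset.range n := by
  classical
  obtain ⟨N, hN⟩ := Finset.exists_nat_subset_range (A.biUnion Finsupp.support)
  exact ⟨N, fun n hn ν hν => (Finset.subset_biUnion_of_mem Finsupp.support hν).trans
    (hN.trans (Finset.range_subset_range.2 hn))⟩

theorem injOn_restrict_fin {A : Finset (ℕ →₀ ℕ)} {N : ℕ}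
    (hA : ∀ ν ∈ A, ν.support ⊆ Finset.range N) :
    Set.InjOn (fun (ν : ℕ →₀ ℕ) (j : Fin N) => ν j) A := by
  intro ν hν ν' hν' h
  ext j
  by_cases hj : j < N
  · exact congrFun h ⟨j, hj⟩
  · have h0 (μ : ℕ →₀ ℕ) (hμ : μ ∈ A) : μ j = 0 :=
      Finsupp.notMem_support_iff.1 fun hmem => hj (Finset.mem_range.1 (hA μ hμ hmem))
    rw [h0 ν hν, h0 ν' hν']

theorem memLp_hermiteMulti (ν : ℕ →₀ ℕ) : MemLp (hermiteMulti ν) 2 gaussInf := by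
  obtain ⟨N, hN⟩ := exists_support_subset_range {ν}
  have h := (memLp_two_prod_pi (μ := fun _ : Fin N => gaussianReal 0 1)
    fun j => memLp_hermiteFun (ν j)).comp_measurePreserving (measurePreserving_gaussInf_gaussN N)
  rw [funext (hermiteMulti_eq_prod_fin (hN N le_rfl ν (by simp)))]
  exact h

theorem continuous_prod_hermiteFun {N : ℕ} (ν : Fin N → ℕ) :
    Continuous fun y : Fin N → ℝ => ∏ j, hermiteFun (ν j) (y j) :=
  continuous_finsetProd _ fun j _ => (continuous_hermiteFun _).comp (continuous_apply j)

section

variable {X : Type*} [NormedAddCommGroup X] [InnerProductSpace ℂ X]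

theorem hermiteCoeff_comp_fin {N : ℕ} {v : (Fin N → ℝ) → X} (hv : Continuous v) {ν : ℕ →₀ ℕ}
    (hν : ν.support ⊆ Finset.range N) :
    hermiteCoeff (fun y => v fun i : Fin N => y i) ν = hermiteCoeffN v fun j => ν j := by
  have hmp := measurePreserving_gaussInf_gaussN N
  have hc : Continuous fun y : Fin N → ℝ =>
      ((∏ j : Fin N, hermiteFun (ν j) (y j) : ℝ) : ℂ) • v y :=
    (Complex.continuous_ofReal.comp (continuous_prod_hermiteFun _)).smul hv
  rw [hermiteCoeffN, ← hmp.map_eq,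
    integral_map hmp.measurable.aemeasurable hc.aestronglyMeasurable, hermiteCoeff]
  simp only [hermiteMulti_eq_prod_fin hν]

/-- The coefficients are continuous in `L²(γ; X)`, by Hölder's inequality. -/
theorem norm_hermiteCoeff_le (ν : ℕ →₀ ℕ) {f : (ℕ → ℝ) → X} (hf : MemLp f 2 gaussInf) :
    ENNReal.ofReal ‖hermiteCoeff f ν‖ ≤
      eLpNorm (hermiteMulti ν) 2 gaussInf * eLpNorm f 2 gaussInf := by
  have hH : MemLp (fun y => (hermiteMulti ν y : ℂ)) 2 gaussInf := (memLp_hermiteMulti ν).ofReal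
  have h1 : eLpNorm (fun y => (hermiteMulti ν y : ℂ)) 2 gaussInf =
      eLpNorm (hermiteMulti ν) 2 gaussInf :=
    eLpNorm_congr_norm_ae (ae_of_all _ fun y => Complex.norm_real _)
  rw [← h1, ofReal_norm, hermiteCoeff]
  refine (enorm_integral_le_lintegral_enorm _).trans ?_
  rw [← eLpNorm_one_eq_lintegral_enorm]
  exact eLpNorm_smul_le_mul_eLpNorm (p := 2) (q := 2) (r := 1) hf.1 hH.1

theorem hermiteCoeff_sub (ν : ℕ →₀ ℕ) {f g : (ℕ → ℝ) → X} (hf : MemLp f 2 gaussInf)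
    (hg : MemLp g 2 gaussInf) :
    hermiteCoeff (fun y => f y - g y) ν = hermiteCoeff f ν - hermiteCoeff g ν := by
  have hH : MemLp (fun y => (hermiteMulti ν y : ℂ)) 2 gaussInf := (memLp_hermiteMulti ν).ofReal
  simp only [hermiteCoeff, smul_sub]
  exact integral_sub (integrable_smul_of_memLp hH hf) (integrable_smul_of_memLp hH hg)

variable {u : (ℕ → ℝ) → X} {b : ℕ → ℝ} {ξ δ : ℝ} {v : (N : ℕ) → (Fin N → ℝ) → X}

theorem tendsto_hermiteCoeffN (hu : MemLp u 2 gaussInf) (hv : IsHolomorphicFamily u b ξ 2 δ v)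
    (hb : ∀ j, 0 < b j) (hξ : 0 < ξ) (ν : ℕ →₀ ℕ) :
    Tendsto (fun N => hermiteCoeffN (v N) fun j => ν j) atTop (𝓝 (hermiteCoeff u ν)) := by
  obtain ⟨N₀, hN₀⟩ := exists_support_subset_range {ν}
  have h0 : Tendsto (fun N => eLpNorm (hermiteMulti ν) 2 gaussInf *
      eLpNorm (fun y : ℕ → ℝ => u y - v N fun i : Fin N => y i) 2 gaussInf) atTop (𝓝 0) := by
    simpa using ENNReal.Tendsto.const_mul hv.converges (Or.inr (memLp_hermiteMulti ν).2.ne)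
  rw [tendsto_iff_norm_sub_tendsto_zero]
  have h1 : Tendsto (fun N => ENNReal.ofReal
      ‖hermiteCoeffN (v N) (fun j => ν j) - hermiteCoeff u ν‖) atTop (𝓝 0) := by
    refine tendsto_of_tendsto_of_tendsto_of_le_of_le' tendsto_const_nhds h0
      (Eventually.of_forall fun _ => zero_le) ?_
    filter_upwards [eventually_ge_atTop (max 1 N₀)] with N hN
    have hN1 : 1 ≤ N := (le_max_left _ _).trans hN
    have hvN : MemLp (fun y : ℕ → ℝ => v N fun i : Fin N => y i) 2 gaussInf :=
      (hv.memLp hb hξ hN1).comp_measurePreserving (measurePreserving_gaussInf_gaussN N)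
    rw [norm_sub_rev, ← hermiteCoeff_comp_fin (hv.continuous hb hξ hN1)
      (hN₀ N ((le_max_right _ _).trans hN) ν (by simp)), ← hermiteCoeff_sub ν hu hvN]
    exact norm_hermiteCoeff_le ν (hu.sub hvN)
  have h2 := (ENNReal.tendsto_toReal ENNReal.zero_ne_top).comp h1
  simpa [Function.comp_def] using h2

theorem sum_betaWeight_mul_norm_hermiteCoeff_sq_le [CompleteSpace X] (hu : MemLp u 2 gaussInf)
    (hv : IsHolomorphicFamily u b ξ 2 δ v) (hb : ∀ j, 0 < b j) (hξ : 0 < ξ) (hδ : 0 < δ) {M : ℕ}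
    {ϱ a : ℕ → ℝ} (hϱ : ∀ j, ϱ j ^ 2 * b j ^ 2 =
      a j * (ξ ^ 2 / (8 * Real.exp 1 * (M.factorial : ℝ)))) (ha : ∀ j, 0 ≤ a j)
    (hϱ0 : ∀ j, 0 < ϱ j) (ha1 : ∀ N, ∑ j : Fin N, a j ≤ 1) (A : Finset (ℕ →₀ ℕ)) :
    ∑ ν ∈ A, betaWeight M ϱ ν * ‖hermiteCoeff u ν‖ ^ 2 ≤ 2 * δ ^ 2 := by
  classical
  obtain ⟨N₀, hN₀⟩ := exists_support_subset_range A
  have hlim : Tendsto (fun N => ∑ ν ∈ A,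
      betaWeight M ϱ ν * ‖hermiteCoeffN (v N) fun j => ν j‖ ^ 2) atTop
      (𝓝 (∑ ν ∈ A, betaWeight M ϱ ν * ‖hermiteCoeff u ν‖ ^ 2)) :=
    tendsto_finsetSum _ fun ν _ =>
      (((tendsto_hermiteCoeffN hu hv hb hξ ν).norm).pow 2).const_mul _
  refine le_of_tendsto hlim ?_
  filter_upwards [eventually_ge_atTop (max 1 N₀)] with N hN
  have hN1 : 1 ≤ N := (le_max_left _ _).trans hN
  have hsupp := hN₀ N ((le_max_right _ _).trans hN)
  have hfin := sum_prod_mul_norm_hermiteCoeffN_sq_le hv hb hξ hδ hϱ ha hϱ0 hN1 (ha1 N)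
    (A.image fun ν (j : Fin N) => ν j)
  rw [Finset.sum_image (injOn_restrict_fin hsupp)] at hfin
  refine (Finset.sum_congr rfl fun ν hν => ?_).trans_le hfin
  rw [betaWeight_eq_prod_fin M ϱ (hsupp ν hν)]

end

/-! ### Summability of products over finitely supported multi-indices -/

/-- A product family is summable over the finitely supported multi-indices if its nontrivial
factors are dominated by `s_j t_n` with `s` and `t` summable: the sum is at most
`∏_j (1 + s_j ∑ t) ≤ exp (∑ s · ∑ t)`. -/
theorem summable_prod_support {h : ℕ → ℕ → ℝ} {s t : ℕ → ℝ} (h0 : ∀ j, h j 0 = 1)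
    (hnn : ∀ j n, 0 ≤ h j n) (hs0 : ∀ j, 0 ≤ s j) (ht0 : ∀ n, 0 ≤ t n) (hs : Summable s)
    (ht : Summable t) (hle : ∀ j n, 1 ≤ n → h j n ≤ s j * t n) :
    Summable fun ν : ℕ →₀ ℕ => ∏ j ∈ ν.support, h j (ν j) := by
  classical
  refine summable_of_sum_le (c := Real.exp ((∑' j, s j) * ∑' n, t n))
    (fun ν => Finset.prod_nonneg fun j _ => hnn _ _) fun A => ?_
  obtain ⟨N, hN⟩ := exists_support_subset_range A
  replace hN := hN N le_rfl
  obtain ⟨K, hK⟩ := Finset.exists_nat_subset_range (A.biUnion fun ν => ν.support.image ν)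
  have hK' : ∀ ν ∈ A, ∀ j, ν j ∈ Finset.range (K + 1) := by
    intro ν hν j
    by_cases hj : j ∈ ν.support
    · have := Finset.mem_range.1 (hK (Finset.mem_biUnion.2 ⟨ν, hν, Finset.mem_image_of_mem _ hj⟩))
      exact Finset.mem_range.2 (by omega)
    · rw [Finsupp.notMem_support_iff.1 hj]
      simp
  have hT (j : ℕ) : ∑ n ∈ Finset.range (K + 1), h j n ≤ 1 + s j * ∑' n, t n := by
    rw [Finset.sum_range_succ', h0, add_comm]
    gcongr
    calc ∑ n ∈ Finset.range K, h j (n + 1) ≤ ∑ n ∈ Finset.range K, s j * t (n + 1) :=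
          Finset.sum_le_sum fun n _ => hle j (n + 1) (by omega)
      _ = s j * ∑ n ∈ Finset.range K, t (n + 1) := by rw [Finset.mul_sum]
      _ ≤ s j * ∑' n, t n := by
          have h1 : ∑ n ∈ Finset.range (K + 1), t n ≤ ∑' n, t n :=
            ht.sum_le_tsum _ fun n _ => ht0 n
          rw [Finset.sum_range_succ'] at h1
          have := ht0 0
          exact mul_le_mul_of_nonneg_left (by linarith) (hs0 j)
  calc ∑ ν ∈ A, ∏ j ∈ ν.support, h j (ν j)
      = ∑ ν ∈ A, ∏ j : Fin N, h j (ν j) :=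
        Finset.sum_congr rfl fun ν hν => prod_support_eq_prod_fin h0 (hN ν hν)
    _ = ∑ f ∈ A.image fun (ν : ℕ →₀ ℕ) (j : Fin N) => ν j, ∏ j : Fin N, h j (f j) :=
        (Finset.sum_image (f := fun f : Fin N → ℕ => ∏ j : Fin N, h j (f j))
          (injOn_restrict_fin hN)).symm
    _ ≤ ∑ f ∈ Fintype.piFinset fun _ : Fin N => Finset.range (K + 1), ∏ j : Fin N, h j (f j) := by
        refine Finset.sum_le_sum_of_subset_of_nonneg (fun f hf => ?_) fun f _ _ =>
          Finset.prod_nonneg fun j _ => hnn _ _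
        obtain ⟨ν, hν, rfl⟩ := Finset.mem_image.1 hf
        exact Fintype.mem_piFinset.2 fun j => hK' ν hν j
    _ = ∏ j : Fin N, ∑ n ∈ Finset.range (K + 1), h j n := by rw [Finset.prod_univ_sum]
    _ ≤ ∏ j : Fin N, (1 + s j * ∑' n, t n) :=
        Finset.prod_le_prod (fun j _ => Finset.sum_nonneg fun n _ => hnn _ _) fun j _ => hT j
    _ ≤ Real.exp (∑ j : Fin N, s j * ∑' n, t n) := Real.prod_one_add_le_exp_sum _ fun j =>
        mul_nonneg (hs0 j) (tsum_nonneg ht0)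
    _ ≤ Real.exp ((∑' j, s j) * ∑' n, t n) := by
        rw [← Finset.sum_mul, ← Finset.sum_range fun j => s j]
        gcongr
        · exact tsum_nonneg ht0
        · exact hs.sum_le_tsum _ fun j _ => hs0 j

/-! ### Lower bounds for the weights -/

theorem one_le_sum_choose_mul_pow (M n : ℕ) {x : ℝ} (hx : 0 ≤ x) :
    1 ≤ ∑ l ∈ Finset.range (M + 1), (n.choose l : ℝ) * x ^ (2 * l) := by
  refine le_trans ?_ (Finset.single_le_sum (f := fun l => (n.choose l : ℝ) * x ^ (2 * l))
    (fun l _ => by positivity) (Finset.mem_range.2 (Nat.succ_pos M)))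
  simp

theorem betaWeight_pos (M : ℕ) {ϱ : ℕ → ℝ} (hϱ : ∀ j, 0 < ϱ j) (ν : ℕ →₀ ℕ) :
    0 < betaWeight M ϱ ν :=
  Finset.prod_pos fun j _ => zero_lt_one.trans_le (one_le_sum_choose_mul_pow M _ (hϱ j).le)

/-- Each factor of the weight grows like `n^M` in the order `n` and at least like `x²` in the
radius `x`. The term `l = M` gives this for `n ≥ M`, the term `l = 1` for `n < M`. -/
theorem mul_pow_mul_sq_le_sum_choose {M n : ℕ} (hM : 1 ≤ M) (hn : 1 ≤ n) {x R : ℝ} (hx : 0 < x)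
    (hR : 0 < R) (hRx : R ≤ x ^ 2) :
    min 1 (R ^ (M - 1)) / ((M : ℝ) ^ M * M.factorial) * (n : ℝ) ^ M * x ^ 2 ≤
      ∑ l ∈ Finset.range (M + 1), (n.choose l : ℝ) * x ^ (2 * l) := by
  have hM0 : (0 : ℝ) < M := by exact_mod_cast hM
  have hterm (l : ℕ) (hl : l ≤ M) : (n.choose l : ℝ) * x ^ (2 * l) ≤
      ∑ l ∈ Finset.range (M + 1), (n.choose l : ℝ) * x ^ (2 * l) :=
    Finset.single_le_sum (f := fun l => (n.choose l : ℝ) * x ^ (2 * l))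
      (fun l _ => by positivity) (Finset.mem_range.2 (Nat.lt_succ_of_le hl))
  have hmin0 : 0 < min 1 (R ^ (M - 1)) := lt_min one_pos (by positivity)
  have heq : min 1 (R ^ (M - 1)) / ((M : ℝ) ^ M * M.factorial) * (n : ℝ) ^ M * x ^ 2 =
      (((n : ℝ) / M) ^ M / M.factorial) * (min 1 (R ^ (M - 1)) * x ^ 2) := by
    rw [div_pow]
    field_simp
  rw [heq]
  rcases le_or_gt M n with h | h
  · refine le_trans ?_ (hterm M le_rfl)
    have hchoose : ((n : ℝ) / M) ^ M / M.factorial ≤ n.choose M := by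
      refine le_trans ?_ (Nat.pow_le_choose M n)
      have : (n : ℝ) / M ≤ (n + 1 - M : ℕ) := by
        rw [Nat.cast_sub (by omega), div_le_iff₀ hM0]
        push_cast
        have h1 : (1 : ℝ) ≤ M := by exact_mod_cast hM
        have h2 : (M : ℝ) ≤ n := by exact_mod_cast h
        nlinarith [mul_nonneg (sub_nonneg.2 h1) (sub_nonneg.2 h2)]
      have h0 : 0 ≤ (n : ℝ) / M := by positivity
      exact div_le_div_of_nonneg_right (pow_le_pow_left₀ h0 this M) (Nat.cast_nonneg _)
    have hpow : min 1 (R ^ (M - 1)) * x ^ 2 ≤ x ^ (2 * M) := by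
      obtain ⟨k, rfl⟩ := Nat.exists_eq_add_of_le' hM
      rw [pow_mul, pow_succ (x ^ 2) k, Nat.add_sub_cancel]
      gcongr
      exact (min_le_right _ _).trans (pow_le_pow_left₀ hR.le hRx k)
    gcongr
  · refine le_trans ?_ (hterm 1 hM)
    rw [mul_one, Nat.choose_one_right]
    have h1 : ((n : ℝ) / M) ^ M / M.factorial ≤ n := by
      have hnM : (n : ℝ) / M ≤ 1 := (div_le_one hM0).2 (by exact_mod_cast h.le)
      have : ((n : ℝ) / M) ^ M ≤ 1 := pow_le_one₀ (by positivity) hnM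
      have hf : (1 : ℝ) ≤ M.factorial := by exact_mod_cast M.factorial_pos
      have hn' : (1 : ℝ) ≤ n := by exact_mod_cast hn
      rw [div_le_iff₀ (by positivity)]
      nlinarith
    have h2 : min 1 (R ^ (M - 1)) * x ^ 2 ≤ x ^ 2 :=
      mul_le_of_le_one_left (by positivity) (min_le_left _ _)
    gcongr

theorem summable_betaWeight_inv_rpow {M : ℕ} (hM : 1 ≤ M) {ϱ : ℕ → ℝ} (hϱ : ∀ j, 0 < ϱ j)
    {R q : ℝ} (hR : 0 < R) (hRϱ : ∀ j, R ≤ ϱ j ^ 2) (hq : 0 < q) (hMq : 1 < M * q)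
    (hs : Summable fun j => ((ϱ j ^ 2) ^ q)⁻¹) :
    Summable fun ν : ℕ →₀ ℕ => ((betaWeight M ϱ ν)⁻¹) ^ q := by
  set c : ℝ := min 1 (R ^ (M - 1)) / ((M : ℝ) ^ M * M.factorial) with hc
  have hc0 : 0 < c := by
    have : (0 : ℝ) < M := by exact_mod_cast hM
    have : 0 < min 1 (R ^ (M - 1)) := lt_min one_pos (by positivity)
    positivity
  set g : ℕ → ℕ → ℝ := fun j n =>
    ∑ l ∈ Finset.range (M + 1), (n.choose l : ℝ) * ϱ j ^ (2 * l) with hg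
  have hg1 (j n : ℕ) : 1 ≤ g j n := one_le_sum_choose_mul_pow M n (hϱ j).le
  have hg0 (j : ℕ) : g j 0 = 1 := by
    simp only [hg]
    rw [Finset.sum_range_succ']
    simp
  have hprod (ν : ℕ →₀ ℕ) : ((betaWeight M ϱ ν)⁻¹) ^ q =
      ∏ j ∈ ν.support, ((g j (ν j))⁻¹) ^ q := by
    rw [Real.finsetProd_rpow _ _ fun j _ => inv_nonneg.2 (zero_le_one.trans (hg1 _ _)),
      Finset.prod_inv_distrib]
    rfl
  simp only [hprod]
  have ht : Summable fun n : ℕ => (c ^ q)⁻¹ * ((n : ℝ) ^ (M * q))⁻¹ :=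
    (Real.summable_nat_rpow_inv.2 hMq).mul_left _
  refine summable_prod_support (h := fun j n => ((g j n)⁻¹) ^ q)
    (s := fun j => ((ϱ j ^ 2) ^ q)⁻¹) (t := fun n => (c ^ q)⁻¹ * ((n : ℝ) ^ (M * q))⁻¹)
    (fun j => by simp [hg0]) (fun j n => ?_) (fun j => by positivity) (fun n => by positivity)
    hs ht fun j n hn => ?_
  · have := hg1 j n
    positivity
  · have hlow : c * (n : ℝ) ^ M * ϱ j ^ 2 ≤ g j n :=
      mul_pow_mul_sq_le_sum_choose hM hn (hϱ j) hR (hRϱ j)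
    have hn0 : (0 : ℝ) < n := by exact_mod_cast hn
    have hj := hϱ j
    calc ((g j n)⁻¹) ^ q ≤ ((c * (n : ℝ) ^ M * ϱ j ^ 2)⁻¹) ^ q := by
          have := hg1 j n
          gcongr
      _ = ((ϱ j ^ 2) ^ q)⁻¹ * ((c ^ q)⁻¹ * ((n : ℝ) ^ (M * q))⁻¹) := by
          rw [Real.inv_rpow (by positivity), Real.mul_rpow (by positivity) (by positivity),
            Real.mul_rpow (by positivity) (by positivity), Real.rpow_mul hn0.le, Real.rpow_natCast]
          field_simp

/-- The Hölder step, in pointwise form: by the weighted inequality between the geometric and the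
arithmetic mean, `x^p ≤ (p/2) β x² + (1 - p/2) β^{-p/(2-p)}`. -/
theorem rpow_le_mul_sq_add_inv_rpow {p x β : ℝ} (hp0 : 0 < p) (hp2 : p < 2) (hx : 0 ≤ x)
    (hβ : 0 < β) : x ^ p ≤ p / 2 * (β * x ^ 2) + (1 - p / 2) * (β⁻¹) ^ (p / (2 - p)) := by
  have h2p : 2 - p ≠ 0 := by linarith
  have h := Real.geom_mean_le_arith_mean2_weighted (w₁ := p / 2) (w₂ := 1 - p / 2)
    (p₁ := β * x ^ 2) (p₂ := (β⁻¹) ^ (p / (2 - p))) (by positivity) (by linarith) (by positivity)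
    (by positivity) (by ring)
  refine le_of_eq_of_le ?_ h
  rw [Real.mul_rpow hβ.le (by positivity), ← Real.rpow_natCast x 2, ← Real.rpow_mul hx,
    ← Real.rpow_mul (by positivity), Real.inv_rpow hβ.le]
  have h1 : p / (2 - p) * (1 - p / 2) = p / 2 := by field_simp
  have h2 : ((2 : ℕ) : ℝ) * (p / 2) = p := by push_cast; ring
  rw [h1, h2]
  have := Real.rpow_pos_of_pos hβ (p / 2)
  field_simp

/-! ### The radii attached to an `ℓ^p` sequence -/

section Radii

variable {b : ℕ → ℝ} {p B C : ℝ} {ϱ : ℕ → ℝ}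

theorem div_sq_le_sq_of_radii (hb : ∀ j, 0 < b j) (hB : 0 < B) (hbB : ∀ j, b j ≤ B)
    (hp2 : p < 2) (hC : 0 < C) (hϱ : ∀ j, ϱ j ^ 2 * b j ^ 2 = (b j / B) ^ p * C) (j : ℕ) :
    C / B ^ 2 ≤ ϱ j ^ 2 := by
  have hbj := hb j
  have h1 : (b j / B) ^ 2 ≤ (b j / B) ^ p := by
    have := Real.rpow_le_rpow_of_exponent_ge (div_pos hbj hB) ((div_le_one hB).2 (hbB j)) hp2.le
    exact_mod_cast this
  have h2 : (b j / B) ^ 2 * C ≤ ϱ j ^ 2 * b j ^ 2 := by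
    rw [hϱ]
    gcongr
  refine le_of_mul_le_mul_right (le_of_eq_of_le ?_ h2) (pow_pos hbj 2)
  field_simp

theorem summable_inv_sq_rpow_of_radii (hb : ∀ j, 0 < b j) (hB : 0 < B)
    (hbp : Summable fun j => b j ^ p) (hp2 : p < 2) (hC : 0 < C)
    (hϱ : ∀ j, ϱ j ^ 2 * b j ^ 2 = (b j / B) ^ p * C) :
    Summable fun j => ((ϱ j ^ 2) ^ (p / (2 - p)))⁻¹ := by
  have h2p : 2 - p ≠ 0 := by linarith
  have h (j : ℕ) : ((ϱ j ^ 2) ^ (p / (2 - p)))⁻¹ =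
      ((C / B ^ p) ^ (p / (2 - p)))⁻¹ * b j ^ p := by
    have hbj := hb j
    have h1 : ϱ j ^ 2 = C / B ^ p * (b j ^ (2 - p))⁻¹ := by
      have h3 : b j ^ (2 - p) * b j ^ p = b j ^ 2 := by
        rw [← Real.rpow_add hbj]
        norm_num
      have := Real.rpow_pos_of_pos hB p
      have := Real.rpow_pos_of_pos hbj (2 - p)
      have h4 := hϱ j
      rw [Real.div_rpow hbj.le hB.le, ← h3, mul_comm (b j ^ (2 - p)), ← mul_assoc] at h4
      have := Real.rpow_pos_of_pos hbj p
      field_simp at h4 ⊢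
      linarith
    rw [h1, Real.mul_rpow (by positivity) (by positivity), mul_inv,
      Real.inv_rpow (by positivity), inv_inv, ← Real.rpow_mul hbj.le, mul_div_cancel₀ _ h2p]
  simp only [h]
  exact hbp.mul_left _

end Radii

end GaussHol

theorem theorem3p1 {X : Type*} [NormedAddCommGroup X] [InnerProductSpace ℂ X] [CompleteSpace X]
    [TopologicalSpace.SeparableSpace X]
    (b : ℕ → ℝ) (hb : ∀ j, 0 < b j) (ξ δ : ℝ) (hξ : 0 < ξ) (hδ : 0 < δ)
    (u : (ℕ → ℝ) → X) (hu : GaussHol.IsParamHolomorphic u b ξ 2 δ)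
    (p : ℝ) (hp0 : 0 < p) (hp2 : p < 2) (hbp : Memℓp b (ENNReal.ofReal p))
    (M : ℕ) (hM : 2 / p ≤ (M : ℝ))
    (ϱ : ℕ → ℝ) (hϱ_pos : ∀ j, 0 < ϱ j)
    (hϱ : ∀ j, ϱ j ^ 2 * b j ^ 2 =
      (b j / ‖(⟨b, hbp⟩ : lp (fun _ : ℕ => ℝ) (ENNReal.ofReal p))‖) ^ p *
        (ξ ^ 2 / (8 * Real.exp 1 * (M.factorial : ℝ)))) :
    (Summable (fun ν : ℕ →₀ ℕ =>
        GaussHol.betaWeight M ϱ ν * ‖GaussHol.hermiteCoeff u ν‖ ^ 2) ∧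
      ∑' ν : ℕ →₀ ℕ, GaussHol.betaWeight M ϱ ν * ‖GaussHol.hermiteCoeff u ν‖ ^ 2 ≤ 2 * δ ^ 2) ∧
    Memℓp (fun ν : ℕ →₀ ℕ => (GaussHol.betaWeight M ϱ ν)⁻¹) (ENNReal.ofReal (p / (2 - p))) ∧
    Memℓp (fun ν : ℕ →₀ ℕ => ‖GaussHol.hermiteCoeff u ν‖) (ENNReal.ofReal p) := by
  set bp : lp (fun _ : ℕ => ℝ) (ENNReal.ofReal p) := ⟨b, hbp⟩ with hbp_def
  set B : ℝ := ‖bp‖ with hB_def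
  have hpR : (ENNReal.ofReal p).toReal = p := ENNReal.toReal_ofReal hp0.le
  have hpR0 : 0 < (ENNReal.ofReal p).toReal := by rwa [hpR]
  have hbsum : Summable fun j => b j ^ p := by
    have := (memℓp_gen_iff hpR0).1 hbp
    simpa only [hpR, Real.norm_of_nonneg (hb _).le] using this
  have hBp : B ^ p = ∑' j, b j ^ p := by
    have := lp.norm_rpow_eq_tsum hpR0 bp
    simpa only [hpR, hbp_def, Real.norm_of_nonneg (hb _).le] using this
  have hBpos : 0 < B := by
    refine (lp.norm_nonneg' bp).lt_of_ne' fun h0 => ?_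
    have h1 : B ^ p = 0 := by rw [hB_def, h0, Real.zero_rpow hp0.ne']
    have h2 : 0 < ∑' j, b j ^ p :=
      hbsum.tsum_pos (fun j => (Real.rpow_pos_of_pos (hb j) p).le) 0 (Real.rpow_pos_of_pos (hb 0) p)
    linarith
  have hbB (j : ℕ) : b j ≤ B := by
    have h1 : b j ^ p ≤ B ^ p := by
      rw [hBp]
      exact hbsum.le_tsum j fun i _ => (Real.rpow_pos_of_pos (hb i) p).le
    exact (Real.rpow_le_rpow_iff (hb j).le hBpos.le hp0).1 h1
  have ha0 (j : ℕ) : 0 ≤ (b j / B) ^ p := by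
    have := hb j
    positivity
  have ha1 (N : ℕ) : ∑ j : Fin N, (b j / B) ^ p ≤ 1 := by
    simp only [Real.div_rpow (hb _).le hBpos.le]
    rw [← Finset.sum_div, div_le_one (Real.rpow_pos_of_pos hBpos p), hBp,
      ← Finset.sum_range fun j => b j ^ p]
    exact hbsum.sum_le_tsum _ fun j _ => (Real.rpow_pos_of_pos (hb j) p).le
  have hC : 0 < ξ ^ 2 / (8 * Real.exp 1 * (M.factorial : ℝ)) := by positivity
  obtain ⟨huL, v, hv⟩ := hu
  have hsumle := GaussHol.sum_betaWeight_mul_norm_hermiteCoeff_sq_le huL hv hb hξ hδ hϱ ha0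
    hϱ_pos ha1
  have hnn (ν : ℕ →₀ ℕ) : 0 ≤ GaussHol.betaWeight M ϱ ν * ‖GaussHol.hermiteCoeff u ν‖ ^ 2 :=
    mul_nonneg (GaussHol.betaWeight_pos M hϱ_pos ν).le (sq_nonneg _)
  have hsum := summable_of_sum_le hnn hsumle
  have h2p : 0 < 2 - p := by linarith
  have hM1 : 1 < (M : ℝ) := ((one_lt_div hp0).2 hp2).trans_le hM
  -- `M q ≥ (2/p) · p/(2-p) = 2/(2-p) > 1` for `q = p/(2-p)`
  have hMq : 1 < M * (p / (2 - p)) := by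
    rw [div_le_iff₀ hp0] at hM
    rw [← mul_div_assoc, one_lt_div h2p]
    linarith
  have hβ : Summable fun ν : ℕ →₀ ℕ => ((GaussHol.betaWeight M ϱ ν)⁻¹) ^ (p / (2 - p)) :=
    GaussHol.summable_betaWeight_inv_rpow (by exact_mod_cast hM1.le) hϱ_pos (by positivity)
      (GaussHol.div_sq_le_sq_of_radii hb hBpos hbB hp2 hC hϱ) (div_pos hp0 h2p) hMq
      (GaussHol.summable_inv_sq_rpow_of_radii hb hBpos hbsum hp2 hC hϱ)
  have hqR : (ENNReal.ofReal (p / (2 - p))).toReal = p / (2 - p) :=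
    ENNReal.toReal_ofReal (div_pos hp0 h2p).le
  refine ⟨⟨hsum, hsum.tsum_le_of_sum_le hsumle⟩, memℓp_gen ?_, memℓp_gen ?_⟩
  · refine hβ.congr fun ν => ?_
    rw [hqR, Real.norm_of_nonneg (inv_nonneg.2 (GaussHol.betaWeight_pos M hϱ_pos ν).le)]
  · refine Summable.of_nonneg_of_le (fun ν => by positivity) (fun ν => ?_)
      ((hsum.mul_left (p / 2)).add (hβ.mul_left (1 - p / 2)))
    rw [hpR, norm_norm]
    exact GaussHol.rpow_le_mul_sq_add_inv_rpow hp0 hp2 (norm_nonneg _)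
      (GaussHol.betaWeight_pos M hϱ_pos ν)
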